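/- Let $A$ and $B$ be finitely presented groups with finite generating sets $X$ and $Y$, let $C$ be a group with a finite generating set $Z$, and let $\varphi\colon C\to A$, $\psi\colon C\to B$ be monomorphisms. Let $G=A*_C B$ be the amalgamated product; $A$, $B$, $C$ are regarded as subgroups of $G$. Elements of $A$, $B$, $C$, $G$ are given to algorithms as words in $X^{\pm1}$, $Y^{\pm1}$, $Z^{\pm1}$, $(X\cup Y)^{\pm1}$, respectively. For a subgroup $K$ of a group $H$ put $K^g=g^{-1}Kg$, $$N^*_H(K)=\{g\in H: K\cap K^g\neq 1\},\qquad Z_H(K)=\bigcup_{g\in N^*_H(K)\setminus K}\bigl(K^{g^{-1}}\cap K\bigr).$$ An element of $G$ is *regular* if it does not lie in $(N^*_G(C)\setminus C)\cup Z_G(C)$. A reduced form of $g\in G$ is an expression $g=cg_1\cdots g_r$ with $c\in C$, $g_j\in (A\cup B)\setminus C$, and $g_j,g_{j+1}$ in different factors for all $j$. The element $g$ is *cyclically reduced* if it has a reduced form such that $r=0$; or $r=1$ and $g$ is not conjugate in $G$ to an element of $C$; or $r\ge 2$ and $g_1,g_r$ lie in different factors. Let $CR\subseteq G$ be the set of all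 conjugates of cyclically reduced regular elements. Let $Sub(C)$ be the least family of subgroups of $C$ that contains the finitely generated subgroups of $C$ and is closed under the operations $K\mapsto C\cap aKa^{-1}$ with $a\in A$ or $a\in B$; a member of $Sub(C)$ is described by the words for generators of a finitely generated subgroup and the words for the successive conjugating elements. For $H\in\{A,B\}$ let $\Phi(Sub(C),H)$ be the least family of subsets of $H$ that contains $Sub(C)$ and is closed under the shifts $D\mapsto uDv$ ($u,v\in H$) and under intersections; its members are described as intersections of finitely many (at least one) shifts $uKv$ with $K\in Sub(C)$ and $u,v\in H$. Assume that for each factor $H\in\{A,B\}$ the following problems are decidable. 1. Membership search for $C$: given $w\in H$, decide whether $w\in C$, and if so, write $w$ as a word in the generators $Z$. 2. Coset representative search for $C$: there are a recursive set $S$ of words that contains exactly one representative of each coset $Ch$, $h\in H$, and an algorithm that finds, for a given word $w$, the representative of $Cw$ in $S$. 3. Cardinality search for $\Phi(Sub(C),H)$: given (a description of) $D\in\Phi(Sub(C),H)$, decide whether $D$ is empty, finite or infinite, and if $D$ is finite, list its elements. 4. Conjugacy search in $H$: given $u,v\in H$, decide whether they are conjugate in $H$, and if so, find a conjugator. 5.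 Conjugacy membership search for $C$: given $w\in H$, decide whether $w$ is conjugate in $H$ to an element of $C$, and if so, find such an element and a conjugator. 6. Membership in $N^*_H(C)$ and membership in $Z_H(C)$. Then the conjugacy search problem in $G$ is decidable on $CR\times G$: there is a partial algorithm that takes pairs $(u,v)$ of words representing elements of $G$, halts on all pairs with $u\in CR$ (and arbitrary $v$), and, whenever it halts, answers correctly whether $u$ and $v$ are conjugate in $G$, giving a conjugator if they are. -/

import Mathlib

namespace AmalgCSP

open Monoid

/-! ## Words -/

/-- Words in the alphabet `ι ∪ ι⁻¹`: the letter `(a, true)` is `a`, the letter `(a, false)` is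
`a⁻¹` (the convention of `FreeGroup`). -/
abbrev Word (ι : Type) : Type := List (ι × Bool)

/-- The element of `H` that is represented by a word, where the letter `a` stands for `x a`. -/
def eval {H ι : Type*} [Group H] (x : ι → H) (w : List (ι × Bool)) : H :=
  FreeGroup.lift x (FreeGroup.mk w)

/-! ## The generalized normalizer and the set `Z` -/

section GroupNotions

variable {H : Type*} [Group H]

/-- `K^g = g⁻¹ K g`. -/
def conjSub (K : Subgroup H) (g : H) : Subgroup H :=
  K.map (MulAut.conj g⁻¹).toMonoidHom

/-- The generalized normalizer `N*_H(K) = {g ∈ H | K ∩ K^g ≠ 1}`. -/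
def genNormalizer (K : Subgroup H) : Set H :=
  {g | K ⊓ conjSub K g ≠ ⊥}

/-- `Z_H(K)` is the union of the sets `K^{g⁻¹} ∩ K` over all `g ∈ N*_H(K) ∖ K`. -/
def genCenter (K : Subgroup H) : Set H :=
  ⋃ g ∈ genNormalizer K \ (K : Set H), ((conjSub K g⁻¹ ⊓ K : Subgroup H) : Set H)

/-- The black hole `(N*_H(K) ∖ K) ∪ Z_H(K)`. -/
def blackHole (K : Subgroup H) : Set H :=
  (genNormalizer K \ (K : Set H)) ∪ genCenter K

/-- The least family of subsets of `H` that contains `M` and is closed under the shifts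
`D ↦ u D v` and under intersections. -/
inductive ShiftInter (M : Set (Set H)) : Set H → Prop
  | base (D : Set H) (hD : D ∈ M) : ShiftInter M D
  | shift (u v : H) (D : Set H) (hD : ShiftInter M D) :
      ShiftInter M ((fun h => u * h * v) '' D)
  | inter (D E : Set H) (hD : ShiftInter M D) (hE : ShiftInter M E) : ShiftInter M (D ∩ E)

end GroupNotions

/-! ## Algorithmic problems in a group with a finite generating tuple -/

section Problems

variable {H : Type*} [Group H] {ι : Type} [Primcodable ι]

/-- The membership problem for a subset `S` of `H`. -/
def MembershipDecidable (x : ι → H) (S : Set H) : Prop :=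
  ComputablePred fun w : Word ι => eval x w ∈ S

/-- The conjugacy search problem is decidable on the set `Φ` of pairs: there is a partial algorithm
that halts on all inputs from `Φ` and whose answers are correct wherever it halts. The answer
`none` means "not conjugate", the answer `some p` gives a conjugator. -/
def ConjSearchDecidableOn (x : ι → H) (Φ : Set (H × H)) : Prop :=
  ∃ f : Word ι × Word ι →. Option (Word ι), Partrec f ∧
    (∀ u v : Word ι, (eval x u, eval x v) ∈ Φ → (f (u, v)).Dom) ∧
    ∀ u v : Word ι,
      (∀ p, some p ∈ f (u, v) → (eval x p)⁻¹ * eval x u * eval x p = eval x v) ∧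
      (none ∈ f (u, v) → ¬ IsConj (eval x u) (eval x v))

/-- The membership search problem for the image of `φ : C →* H`, where `C` is generated by the
tuple `z`: decide whether a word represents an element of `φ(C)`, and if so, write this element as
a word in the generators. -/
def MembershipSearchDecidable {C κ : Type*} [Group C] [Primcodable κ] (x : ι → H)
    (φ : C →* H) (z : κ → C) : Prop :=
  ∃ f : Word ι → Option (List (κ × Bool)), Computable f ∧ ∀ w : Word ι,
    (∀ c, f w = some c → φ (eval z c) = eval x w) ∧
    (f w = none → eval x w ∉ φ.range)

/-- The coset representative search problem for the subgroup `K`: there are a recursive set `S` of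
words that represents every right coset `K h` exactly once, and an algorithm that finds for every
word `w` the representative of `K w` in `S`. -/
def CosetRepSearchDecidable (x : ι → H) (K : Subgroup H) : Prop :=
  ∃ (S : Set (Word ι)) (f : Word ι → Word ι),
    ComputablePred (fun w => w ∈ S) ∧
    (∀ h : H, ∃! s : Word ι, s ∈ S ∧ eval x s * h⁻¹ ∈ K) ∧
    Computable f ∧
    ∀ w : Word ι, f w ∈ S ∧ eval x (f w) * (eval x w)⁻¹ ∈ K

/-- The conjugacy membership search problem for the subgroup `K`: decide whether a word represents
a conjugate of an element of `K`, and if so, find such an element `d` of `K` and a conjugator. -/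
def ConjMembershipSearchDecidable (x : ι → H) (K : Subgroup H) : Prop :=
  ∃ f : Word ι → Option (Word ι × Word ι), Computable f ∧ ∀ w : Word ι,
    (∀ d p, f w = some (d, p) →
      eval x d ∈ K ∧ (eval x p)⁻¹ * eval x w * eval x p = eval x d) ∧
    (f w = none → ∀ d ∈ K, ¬ IsConj (eval x w) d)

end Problems

/-! ## Amalgamated products

The two factors are `F false` and `F true`, the amalgamated subgroup is `C`, embedded by
`φ i : C →* F i`, and the amalgamated product is `Monoid.PushoutI φ`. -/

section Amalgam

variable {F : Bool → Type*} [∀ i, Group (F i)] {C : Type*} [Group C] (φ : ∀ i, C →* F i)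

/-- The element `g` is cyclically reduced: it has a reduced form `g = c g₁ ⋯ gₙ` (the `gⱼ` are
elements of the factors outside `C`, neighbours lying in different factors) such that `n = 0`, or
`n = 1` and `g` is not conjugate to an element of `C`, or `n ≥ 2` and `g₁`, `gₙ` lie in different
factors. -/
def IsCyclicallyReduced (g : PushoutI φ) : Prop :=
  ∃ (c : C) (w : CoprodI.Word F), PushoutI.Reduced φ w ∧
    g = PushoutI.base φ c * PushoutI.ofCoprodI w.prod ∧
    (w.toList.length = 0 ∨
      (w.toList.length = 1 ∧ ∀ c' : C, ¬ IsConj g (PushoutI.base φ c')) ∨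
      (2 ≤ w.toList.length ∧
        w.toList.head?.map Sigma.fst ≠ w.toList.getLast?.map Sigma.fst))

/-- Regular elements: those outside the black hole of `C` in the amalgamated product. -/
def IsRegular (g : PushoutI φ) : Prop :=
  g ∉ blackHole (PushoutI.base φ).range

/-- `CR`: the conjugates of cyclically reduced regular elements. -/
def CR : Set (PushoutI φ) :=
  {g | ∃ r, IsCyclicallyReduced φ r ∧ IsRegular φ r ∧ IsConj g r}

/-- The generating tuple of the amalgamated product given by generating tuples of the factors. -/
def amalgGen {n : Bool → ℕ} (x : ∀ i, Fin (n i) → F i) :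
    Fin (n false) ⊕ Fin (n true) → PushoutI φ :=
  Sum.elim (fun a => PushoutI.of false (x false a)) (fun b => PushoutI.of true (x true b))

/-! ### Finitely described subgroups of `C` and the sets in `Φ(Sub(C), F i)` -/

/-- The subgroup `C ∩ a K a⁻¹` of `C`, computed in the factor `F i`. -/
def capConj (i : Bool) (a : F i) (K : Subgroup C) : Subgroup C :=
  ((K.map (φ i)).map (MulAut.conj a).toMonoidHom).comap (φ i)

/-- The subgroups of `C` that have a finite description: the least family that contains the
finitely generated subgroups of `C` and is closed under `K ↦ C ∩ a K a⁻¹` for `a` in a factor. -/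
inductive DescribedSub : Subgroup C → Prop
  | fg (K : Subgroup C) (hK : K.FG) : DescribedSub K
  | capConj (i : Bool) (a : F i) (K : Subgroup C) (hK : DescribedSub K) :
      DescribedSub (capConj φ i a K)

/-- The family `Φ(Sub(C), F i)`. -/
def shiftFamily (i : Bool) : Set (Set (F i)) :=
  {D | ShiftInter {E | ∃ K, DescribedSub φ K ∧ E = ((K.map (φ i) : Subgroup (F i)) : Set (F i))} D}

/-- Description of a subgroup of `C`: a list of words that generate a subgroup of `C`, and a list
of words in the generators of a factor by which one successively conjugates and intersects. -/
abbrev SubDesc (n : Bool → ℕ) (k : ℕ) : Type :=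
  List (Word (Fin k)) × List (Word (Fin (n false)) ⊕ Word (Fin (n true)))

variable {n : Bool → ℕ} {k : ℕ} (x : ∀ i, Fin (n i) → F i) (z : Fin k → C)

/-- One step `K ↦ C ∩ a K a⁻¹`, with `a` given by a word. -/
def stepDesc (p : Word (Fin (n false)) ⊕ Word (Fin (n true))) (K : Subgroup C) : Subgroup C :=
  p.elim (fun w => capConj φ false (eval (x false) w) K)
    (fun w => capConj φ true (eval (x true) w) K)

/-- The subgroup of `C` with a given description. -/
def SubDesc.den (d : SubDesc n k) : Subgroup C :=
  d.2.foldr (stepDesc φ x) (Subgroup.closure {c | ∃ w ∈ d.1, c = eval z w})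

/-- Description of a set in `Φ(Sub(C), F i)`: a non-empty list (head and tail) of triples
`(u, K, v)`, which stands for the intersection of the shifts `u K v`. -/
abbrev SetDesc (n : Bool → ℕ) (k : ℕ) (i : Bool) : Type :=
  (Word (Fin (n i)) × SubDesc n k × Word (Fin (n i))) ×
    List (Word (Fin (n i)) × SubDesc n k × Word (Fin (n i)))

/-- The shift `u K v` described by a triple. -/
def shiftDen (i : Bool) (t : Word (Fin (n i)) × SubDesc n k × Word (Fin (n i))) : Set (F i) :=
  (fun h => eval (x i) t.1 * h * eval (x i) t.2.2) ''
    (((SubDesc.den φ x z t.2.1).map (φ i) : Subgroup (F i)) : Set (F i))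

/-- The subset of `F i` with a given description. -/
def SetDesc.den (i : Bool) (d : SetDesc n k i) : Set (F i) :=
  {g | ∀ t ∈ d.1 :: d.2, g ∈ shiftDen φ x z i t}

/-- The cardinality search problem for `Φ(Sub(C), F i)`: given a set `D` of this family, decide
whether it is empty, finite or infinite, and list its elements if it is finite. The answer `none`
means "infinite", the answer `some l` means that `l` is a list of all elements of `D`. -/
def CardinalitySearchDecidable (i : Bool) : Prop :=
  ∃ f : SetDesc n k i → Option (List (Word (Fin (n i)))), Computable f ∧ ∀ d : SetDesc n k i,
    (∀ l, f d = some l → SetDesc.den φ x z i d = {g | ∃ w ∈ l, g = eval (x i) w}) ∧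
    (f d = none → (SetDesc.den φ x z i d).Infinite)

end Amalgam

/-! ### The descriptions name exactly the sets of the family -/

section Adequacy

variable {F : Bool → Type*} [∀ i, Group (F i)] {C : Type*} [Group C] (φ : ∀ i, C →* F i)
  {n : Bool → ℕ} {k : ℕ} (x : ∀ i, Fin (n i) → F i) (z : Fin k → C)

theorem eval_surjective {H ι : Type*} [Group H] (x : ι → H)
    (hx : Subgroup.closure (Set.range x) = ⊤) (h : H) : ∃ w, eval x w = h := by
  have h1 : h ∈ (FreeGroup.lift x).range := by
    rw [FreeGroup.range_lift_eq_closure, hx]; trivial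
  obtain ⟨y, rfl⟩ := h1
  classical
  exact ⟨y.toWord, by rw [eval, FreeGroup.mk_toWord]⟩

theorem describedSub_iff (hx : ∀ i, Subgroup.closure (Set.range (x i)) = ⊤)
    (hz : Subgroup.closure (Set.range z) = ⊤) (K : Subgroup C) :
    DescribedSub φ K ↔ ∃ d : SubDesc n k, SubDesc.den φ x z d = K := by
  constructor
  · intro h
    induction h with
    | fg K hK =>
      obtain ⟨S, rfl⟩ := hK
      choose f hf using eval_surjective z hz
      refine ⟨(S.toList.map f, []), ?_⟩
      simp only [SubDesc.den, List.foldr_nil]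
      congr 1
      ext c
      simp [hf]
    | capConj i a K hK ih =>
      obtain ⟨d, rfl⟩ := ih
      obtain ⟨w, rfl⟩ := eval_surjective (x i) (hx i) a
      cases i
      · exact ⟨(d.1, Sum.inl w :: d.2), rfl⟩
      · exact ⟨(d.1, Sum.inr w :: d.2), rfl⟩
  · rintro ⟨⟨L, P⟩, rfl⟩
    induction P with
    | nil =>
      refine DescribedSub.fg _ ((Subgroup.fg_iff _).2 ⟨_, rfl, ?_⟩)
      have : {c | ∃ w ∈ L, c = eval z w} = (eval z) '' {w | w ∈ L} := by
        ext c; simp [eq_comm]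
      rw [this]
      exact (List.finite_toSet L).image _
    | cons p P ih =>
      cases p
      · exact DescribedSub.capConj _ _ _ ih
      · exact DescribedSub.capConj _ _ _ ih

theorem mem_shiftFamily_iff (hx : ∀ i, Subgroup.closure (Set.range (x i)) = ⊤)
    (hz : Subgroup.closure (Set.range z) = ⊤) (i : Bool) (D : Set (F i)) :
    D ∈ shiftFamily φ i ↔ ∃ d : SetDesc n k i, SetDesc.den φ x z i d = D := by
  constructor
  · intro h
    change ShiftInter _ D at h
    induction h with
    | base D hD =>
      obtain ⟨K, hK, rfl⟩ := hD
      obtain ⟨d, rfl⟩ := (describedSub_iff φ x z hx hz K).1 hK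
      refine ⟨(([], d, []), []), ?_⟩
      ext g
      simp [SetDesc.den, shiftDen, eval]
    | shift u v D hD ih =>
      obtain ⟨d, rfl⟩ := ih
      obtain ⟨u, rfl⟩ := eval_surjective (x i) (hx i) u
      obtain ⟨v, rfl⟩ := eval_surjective (x i) (hx i) v
      let s : Word (Fin (n i)) × SubDesc n k × Word (Fin (n i)) →
        Word (Fin (n i)) × SubDesc n k × Word (Fin (n i)) := fun t => (u ++ t.1, t.2.1, t.2.2 ++ v)
      have happ : ∀ a b, eval (x i) (a ++ b) = eval (x i) a * eval (x i) b := by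
        intro a b
        simp only [eval, ← map_mul, FreeGroup.mul_mk]
      have hs : ∀ t g, eval (x i) u * g * eval (x i) v ∈ shiftDen φ x z i (s t) ↔
          g ∈ shiftDen φ x z i t := by
        intro t g
        simp only [shiftDen, s, Set.mem_image, happ]
        refine exists_congr fun h => and_congr_right fun _ => ?_
        rw [show eval (x i) u * eval (x i) t.1 * h * (eval (x i) t.2.2 * eval (x i) v) =
          eval (x i) u * (eval (x i) t.1 * h * eval (x i) t.2.2) * eval (x i) v by group]
        simp
      refine ⟨(s d.1, d.2.map s), ?_⟩
      ext g
      obtain ⟨g, rfl⟩ : ∃ g', g = eval (x i) u * g' * eval (x i) v :=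
        ⟨(eval (x i) u)⁻¹ * g * (eval (x i) v)⁻¹, by group⟩
      have h1 : eval (x i) u * g * eval (x i) v ∈
          ((fun h => eval (x i) u * h * eval (x i) v) '' SetDesc.den φ x z i d) ↔ g ∈ SetDesc.den φ x z i d := by
        constructor
        · rintro ⟨h, hh, he⟩
          have : h = g := by simpa using he
          exact this ▸ hh
        · exact fun h => ⟨g, h, rfl⟩
      refine Iff.trans ?_ h1.symm
      simp only [SetDesc.den, Set.mem_ofPred_eq, List.forall_mem_cons, List.forall_mem_map, hs]
    | inter D E hD hE ihD ihE =>
      obtain ⟨d, rfl⟩ := ihD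
      obtain ⟨e, rfl⟩ := ihE
      refine ⟨(d.1, d.2 ++ e.1 :: e.2), ?_⟩
      ext g
      simp only [SetDesc.den, Set.mem_ofPred_eq, Set.mem_inter_iff, ← List.cons_append,
        List.forall_mem_append]
  · rintro ⟨⟨t, L⟩, rfl⟩
    have hsh : ∀ t, ShiftInter {E | ∃ K, DescribedSub φ K ∧
        E = ((K.map (φ i) : Subgroup (F i)) : Set (F i))} (shiftDen φ x z i t) := fun t =>
      ShiftInter.shift _ _ _ (ShiftInter.base _
        ⟨_, (describedSub_iff φ x z hx hz _).2 ⟨_, rfl⟩, rfl⟩)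
    change ShiftInter _ _
    induction L generalizing t with
    | nil =>
      have h1 : SetDesc.den φ x z i (t, []) = shiftDen φ x z i t := by
        ext g
        simp [SetDesc.den]
      rw [h1]
      exact hsh t
    | cons s L ih =>
      have h1 : SetDesc.den φ x z i (t, s :: L) =
          shiftDen φ x z i t ∩ SetDesc.den φ x z i (s, L) := by
        ext g
        simp only [SetDesc.den, Set.mem_ofPred_eq, Set.mem_inter_iff, List.forall_mem_cons]
      rw [h1]
      exact ShiftInter.inter _ _ (hsh t) (ih s)

end Adequacy

end AmalgCSP

open AmalgCSP

open AmalgCSP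

/-! ## Computable functions and predicates -/

section Computability

variable {α β σ : Type*} [Primcodable α] [Primcodable β] [Primcodable σ]

/-! The algorithm is one unbounded search. Given `u` and `v`, it looks either for a conjugator or
for a certificate of non-conjugacy: conjugators that take `u` and `v` to the values of two lists of
syllables `l`, `m` satisfying the decidable condition `NotConj`. Candidates can be checked because
the word problem in the amalgam is decidable (`Effective.lval_eq_one`). Correctness of every answer
amounts to soundness of the certificates, which needs no regularity (`NotConj.sound`). Halting on
`CR` amounts to their existence when `l` represents a regular element (`notConj_of_regular`).

Every element is conjugate to a representative of one of three types: an element of `C`, an element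
of a factor that is not conjugate there into `C`, or a cyclically reduced list of at least two
syllables. Representatives of different types are never conjugate. Within a type, conjugacy is
controlled as follows. A nontrivial element of `C` outside the sets `Z` of both factors is
conjugated into `C` only by elements of `C` (`mem_base_of_conj_mem_base`). Elements of the second
type are conjugate only inside their factor (`conj_of_syllable`). Conjugate cyclically reduced lists
differ by a rotation and a conjugation by an element of `C` (`exists_rotation_of_conj`). All this
rests on the normal form theorem `Red.eq_nil`.

There remains the equation `d⁻¹ p d = q` with `d ∈ C` and `p`, `q` cyclically reduced of equal
length. It is relaxed to `p d = l q` with `l ∈ C` arbitrary. Cancelling one pair of leading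
syllables at a time, one finds that the set of solutions `d` is empty or a coset of a subgroup
obtained from `C` by steps `K ↦ C ∩ a⁻¹ K a` (`twistSet_cons`). Emptiness tests for intersections of
shifts decide whether a step is possible, and a search then finds the next coset representative. The
final subgroup is contained in `C ∩ p⁻¹ C p`, which is trivial for regular `p`, because `p ∉ C`. So
at most one candidate `d` is left, and it is tested in the original equation. -/

theorem Computable.list_foldl {f : α → List β} {g : α → σ} {h : α → σ × β → σ}
    (hf : Computable f) (hg : Computable g) (hh : Computable₂ h) :
    Computable fun a => (f a).foldl (fun s b => h a (s, b)) (g a) := by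
  -- The fold is a recursion on the number of entries already consumed, with entry `j` looked up by
  -- its index.
  have key : Computable fun a => Nat.rec (motive := fun _ => σ) (g a)
      (fun j s => Option.casesOn (motive := fun _ => σ) (f a)[j]? s (fun b => h a (s, b)))
      (f a).length := by
    refine Computable.nat_rec (Computable.list_length.comp hf) hg
      (h := fun a p => Option.casesOn (motive := fun _ => σ) (f a)[p.1]? p.2
        (fun b => h a (p.2, b))) ?_
    refine Computable.option_casesOn (f := fun q : α × ℕ × σ => q.2.2)
      (g := fun q b => h q.1 (q.2.2, b)) ?_ ?_ ?_
    · exact Computable.list_getElem?.comp (hf.comp Computable.fst)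
        (Computable.fst.comp Computable.snd)
    · exact Computable.snd.comp Computable.snd
    · exact hh.comp (Computable.fst.comp Computable.fst)
        ((Computable.snd.comp (Computable.snd.comp Computable.fst)).pair Computable.snd)
  refine key.of_eq fun a => ?_
  have : ∀ m ≤ (f a).length, Nat.rec (motive := fun _ => σ) (g a)
      (fun j s => Option.casesOn (motive := fun _ => σ) (f a)[j]? s (fun b => h a (s, b))) m =
      ((f a).take m).foldl (fun s b => h a (s, b)) (g a) := by
    intro m
    induction m with
    | zero => intro _; simp
    | succ m ih =>
      intro hm
      rw [List.take_succ_eq_append_getElem (by omega), List.foldl_append, ← ih (by omega)]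
      simp [List.getElem?_eq_getElem (show m < (f a).length by omega)]
  simpa using this _ le_rfl

theorem Computable.list_foldr {f : α → List β} {g : α → σ} {h : α → β × σ → σ}
    (hf : Computable f) (hg : Computable g) (hh : Computable₂ h) :
    Computable fun a => (f a).foldr (fun b s => h a (b, s)) (g a) := by
  refine (Computable.list_foldl (h := fun a p => h a (p.2, p.1))
    (Computable.list_reverse.comp hf) hg ?_).of_eq fun a => by simp
  exact hh.comp Computable.fst
    ((Computable.snd.comp Computable.snd).pair (Computable.fst.comp Computable.snd))

theorem Computable.ite_pred {p : α → Prop} [DecidablePred p] {f g : α → σ} (hp : ComputablePred p)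
    (hf : Computable f) (hg : Computable g) : Computable fun a => if p a then f a else g a := by
  refine (Computable.cond (computablePred_iff_computable_decide.1 hp) hf hg).of_eq fun a => ?_
  by_cases h : p a <;> simp [h]

namespace ComputablePred

theorem comp {p : β → Prop} (hp : ComputablePred p) {f : α → β} (hf : Computable f) :
    ComputablePred fun a => p (f a) := by
  obtain ⟨d, h⟩ := hp
  exact ⟨fun a => d (f a), (h.comp hf).of_eq fun a => rfl⟩

theorem of_bool {f : α → Bool} (hf : Computable f) : ComputablePred fun a => f a = true :=
  ⟨inferInstance, by simpa using hf⟩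

theorem and {p q : α → Prop} (hp : ComputablePred p) (hq : ComputablePred q) :
    ComputablePred fun a => p a ∧ q a := by
  obtain ⟨d, h⟩ := hp
  obtain ⟨d', h'⟩ := hq
  exact ⟨inferInstance, (Computable.cond h h' (Computable.const false)).of_eq fun a => by
    by_cases ha : p a <;> simp [ha]⟩

theorem or {p q : α → Prop} (hp : ComputablePred p) (hq : ComputablePred q) :
    ComputablePred fun a => p a ∨ q a := by
  obtain ⟨d, h⟩ := hp
  obtain ⟨d', h'⟩ := hq
  exact ⟨inferInstance, (Computable.cond h (Computable.const true) h').of_eq fun a => by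
    by_cases ha : p a <;> simp [ha]⟩

theorem forall_mem_list {p : α × β → Prop} (hp : ComputablePred p) {f : α → List β}
    (hf : Computable f) : ComputablePred fun a => ∀ b ∈ f a, p (a, b) := by
  obtain ⟨d, h⟩ := hp
  have hd : Computable fun a => (f a).foldr (fun b s => decide (p (a, b)) && s) true := by
    refine Computable.list_foldr (h := fun a q => decide (p (a, q.1)) && q.2) hf
      (Computable.const true) ?_
    refine (Computable.cond (h.comp (Computable.fst.pair (Computable.fst.comp Computable.snd)))
      (Computable.snd.comp Computable.snd) (Computable.const false)).of_eq fun q => ?_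
    by_cases hq : p (q.1, q.2.1) <;> simp [hq]
  refine (of_bool hd).of_eq fun a => ?_
  generalize f a = l
  induction l with
  | nil => simp
  | cons b l ih => simp [ih]

theorem forall_lt {p : α × ℕ → Prop} (hp : ComputablePred p) {f : α → ℕ}
    (hf : Computable f) : ComputablePred fun a => ∀ j < f a, p (a, j) :=
  (forall_mem_list hp (Primrec.list_range.to_comp.comp hf)).of_eq fun a => by simp

theorem eq [DecidableEq β] {f g : α → β} (hf : Computable f) (hg : Computable g) :
    ComputablePred fun a => f a = g a :=
  (Primrec.eq (α := β)).computablePred.comp (hf.pair hg)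

/-- Search for a witness of a computable relation. -/
theorem exists_search {p : α × β → Prop} (hp : ComputablePred p) :
    ∃ f : α →. β, Partrec f ∧ (∀ a, (f a).Dom ↔ ∃ b, p (a, b)) ∧ ∀ a, ∀ b ∈ f a, p (a, b) := by
  obtain ⟨d, h⟩ := hp
  let g : α → ℕ → Option β := fun a m =>
    (Encodable.decode (α := β) m).bind fun b => if p (a, b) then some b else none
  have hg : Computable₂ g := by
    refine Computable.option_bind (Computable.decode.comp Computable.snd)
      (g := fun (q : α × ℕ) b => if p (q.1, b) then some b else none) ?_
    refine (Computable.cond (h.comp ((Computable.fst.comp Computable.fst).pair Computable.snd))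
      (Computable.option_some.comp Computable.snd) (Computable.const none)).of_eq fun q => ?_
    by_cases hq : p (q.1.1, q.2) <;> simp [hq]
  have hmem : ∀ a m b, b ∈ g a m → p (a, b) := by
    intro a m b hb
    obtain ⟨c, -, hc⟩ := Option.bind_eq_some_iff.1 hb
    by_cases hq : p (a, c)
    · rw [if_pos hq] at hc
      exact Option.some.inj hc ▸ hq
    · simp [hq] at hc
  refine ⟨fun a => Nat.rfindOpt (g a), Partrec.rfindOpt hg, fun a => ?_, fun a b hb => ?_⟩
  · rw [Nat.rfindOpt_dom]
    constructor
    · rintro ⟨m, b, hb⟩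
      exact ⟨b, hmem a m b hb⟩
    · rintro ⟨b, hb⟩
      exact ⟨Encodable.encode b, b, by simp [g, hb]⟩
  · obtain ⟨m, hm⟩ := Nat.rfindOpt_spec hb
    exact hmem a m b hm

/-- A computable relation with computable domain has a computable choice function. -/
theorem exists_choice {p : α × β → Prop} (hp : ComputablePred p)
    (hd : ComputablePred fun a => ∃ b, p (a, b)) :
    ∃ f : α → Option β, Computable f ∧
      (∀ a b, f a = some b → p (a, b)) ∧ ∀ a, f a = none → ∀ b, ¬ p (a, b) := by
  obtain ⟨F, hF, hdom, hspec⟩ := hp.exists_search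
  obtain ⟨d, hc⟩ := hd
  have hG : Partrec fun a => bif decide (∃ b, p (a, b)) then (F a).map some
      else Part.some (none : Option β) :=
    Partrec.cond hc (hF.map (Computable.option_some.comp Computable.snd).to₂)
      (Computable.const none).partrec
  have hall : ∀ a, ∃ o : Option β, (o ∈ (bif decide (∃ b, p (a, b)) then (F a).map some
      else Part.some (none : Option β))) ∧ (∀ b, o = some b → p (a, b)) ∧
        (o = none → ∀ b, ¬ p (a, b)) := by
    intro a
    by_cases ha : ∃ b, p (a, b)
    · obtain ⟨b, hb⟩ := Part.dom_iff_mem.1 ((hdom a).2 ha)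
      refine ⟨some b, ?_, ?_, by simp⟩
      · simpa [ha] using hb
      · rintro c ⟨⟩
        exact hspec a b hb
    · exact ⟨none, by simp [ha], by simp, fun _ b hb => ha ⟨b, hb⟩⟩
  choose f h1 h2 h3 using hall
  exact ⟨f, hG.of_eq_tot h1, h2, h3⟩

end ComputablePred

end Computability

/-! ## Reduced lists of syllables -/

namespace AmalgCSP

open Monoid

/-! ### Alternating sequences of factors -/

section Sides

/-- These are the factors met along `l⁻¹ (a n b) l`, where `a`, `b` lie in factor `i` and `l` does
not begin there: no junction joins two syllables of one factor. -/
theorem isChain_ne_conjugate {K M : List Bool} {i : Bool}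
    (hK : (i :: K).IsChain (· ≠ ·)) (hM : (i :: M ++ [i]).IsChain (· ≠ ·)) :
    (K.reverse ++ (i :: M ++ i :: K)).IsChain (· ≠ ·) := by
  have hK' : (K.reverse ++ [i]).IsChain (· ≠ ·) := by
    rw [← List.reverse_cons, List.isChain_reverse]
    exact hK.imp fun a b h => h.symm
  have h1 : (i :: M ++ i :: K).IsChain (· ≠ ·) := by
    rw [List.isChain_split]
    exact ⟨hM, hK⟩
  simp only [List.cons_append] at h1 ⊢
  rw [List.isChain_split]
  exact ⟨hK', h1⟩

theorem isChain_ne_reverse_append {K : List Bool} {i : Bool} (hK : (i :: K).IsChain (· ≠ ·)) :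
    (K.reverse ++ i :: K).IsChain (· ≠ ·) := by
  rw [List.isChain_split]
  refine ⟨?_, hK⟩
  rw [← List.reverse_cons, List.isChain_reverse]
  exact hK.imp fun a b h => h.symm

/-- A list that starts and ends with the same side is not cyclically alternating. -/
theorem not_isChain_reverse_append_self {K M : List Bool} (hK : K ≠ []) :
    ¬ ((K.reverse ++ M ++ K) ++ (K.reverse ++ M ++ K)).IsChain (· ≠ ·) := by
  intro h
  rw [List.isChain_append] at h
  obtain ⟨i, K, rfl⟩ : ∃ i L, K = L ++ [i] :=
    ⟨K.getLast hK, K.dropLast, (List.dropLast_append_getLast hK).symm⟩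
  exact h.2.2 i (by simp [-List.append_assoc, -List.reverse_append]) i (by simp) rfl

end Sides

/-! ### Normal forms in the amalgamated product -/

section Reduced

variable {F : Bool → Type*} [∀ i, Group (F i)] {C : Type*} [Group C] (φ : ∀ i, C →* F i)

/-- The element of the amalgamated product represented by a list of syllables. -/
def lprod (l : List (Σ i, F i)) : PushoutI φ :=
  (l.map fun s => PushoutI.of s.1 s.2).prod

@[simp] theorem lprod_nil : lprod φ [] = 1 := rfl

@[simp] theorem lprod_cons (s : Σ i, F i) (l : List (Σ i, F i)) :
    lprod φ (s :: l) = PushoutI.of s.1 s.2 * lprod φ l := by simp [lprod]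

@[simp] theorem lprod_append (l m : List (Σ i, F i)) :
    lprod φ (l ++ m) = lprod φ l * lprod φ m := by simp [lprod]

/-- The list of syllables of the inverse element. -/
def linv (l : List (Σ i, F i)) : List (Σ i, F i) :=
  (l.map fun s => (⟨s.1, s.2⁻¹⟩ : Σ i, F i)).reverse

@[simp] theorem linv_nil : linv ([] : List (Σ i, F i)) = [] := rfl

@[simp] theorem linv_cons (s : Σ i, F i) (l : List (Σ i, F i)) :
    linv (s :: l) = linv l ++ [⟨s.1, s.2⁻¹⟩] := by simp [linv]

@[simp] theorem lprod_linv (l : List (Σ i, F i)) : lprod φ (linv l) = (lprod φ l)⁻¹ := by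
  induction l with
  | nil => simp
  | cons s l ih => simp [ih]

@[simp] theorem sides_linv (l : List (Σ i, F i)) :
    (linv l).map Sigma.fst = (l.map Sigma.fst).reverse := by
  simp [linv, Function.comp_def]

/-- No syllable of the list lies in `C`. -/
def NoBase (l : List (Σ i, F i)) : Prop := ∀ s ∈ l, s.2 ∉ (φ s.1).range

/-- Reduced lists of syllables: neighbours lie in different factors, no syllable lies in `C`. -/
def Red (l : List (Σ i, F i)) : Prop :=
  (l.map Sigma.fst).IsChain (· ≠ ·) ∧ NoBase φ l

/-- Cyclically reduced lists of at least two syllables. -/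
def CycRed (l : List (Σ i, F i)) : Prop := l ≠ [] ∧ Red φ (l ++ l)

variable {φ}

@[simp] theorem noBase_nil : NoBase φ [] := by simp [NoBase]

@[simp] theorem noBase_cons {s : Σ i, F i} {l : List (Σ i, F i)} :
    NoBase φ (s :: l) ↔ s.2 ∉ (φ s.1).range ∧ NoBase φ l := by simp [NoBase]

@[simp] theorem noBase_append {l m : List (Σ i, F i)} :
    NoBase φ (l ++ m) ↔ NoBase φ l ∧ NoBase φ m := by
  simp only [NoBase, List.forall_mem_append]

@[simp] theorem noBase_linv {l : List (Σ i, F i)} : NoBase φ (linv l) ↔ NoBase φ l := by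
  induction l with
  | nil => simp
  | cons s l ih => simp only [linv_cons, noBase_append, noBase_cons, ih, inv_mem_iff,
      noBase_nil, and_true]; exact and_comm

theorem Red.tail {s : Σ i, F i} {l : List (Σ i, F i)} (h : Red φ (s :: l)) : Red φ l :=
  ⟨h.1.tail, (noBase_cons.1 h.2).2⟩

theorem CycRed.red {l : List (Σ i, F i)} (h : CycRed φ l) : Red φ l := by
  refine ⟨?_, (noBase_append.1 h.2.2).1⟩
  have := h.2.1
  rw [List.map_append] at this
  exact this.left_of_append

theorem CycRed.two_le {l : List (Σ i, F i)} (h : CycRed φ l) : 2 ≤ l.length := by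
  obtain ⟨h1, h2, -⟩ := h
  match l with
  | [] => exact absurd rfl h1
  | [s] => simp at h2
  | s :: t :: l => simp

theorem base_eq (i : Bool) (c : C) : PushoutI.base φ c = PushoutI.of i (φ i c) :=
  (PushoutI.of_apply_eq_base φ i c).symm

theorem mul_mem_range_iff (i : Bool) (c : C) (g : F i) :
    φ i c * g ∈ (φ i).range ↔ g ∈ (φ i).range :=
  Subgroup.mul_mem_cancel_left _ ⟨c, rfl⟩

theorem Red.absorb {s : Σ i, F i} {l : List (Σ i, F i)} (h : Red φ (s :: l)) (c : C) :
    Red φ (⟨s.1, φ s.1 c * s.2⟩ :: l) := by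
  refine ⟨h.1, ?_⟩
  have := h.2
  rw [noBase_cons] at this ⊢
  exact ⟨by rw [mul_mem_range_iff]; exact this.1, this.2⟩

theorem lprod_absorb (s : Σ i, F i) (l : List (Σ i, F i)) (c : C) :
    lprod φ (⟨s.1, φ s.1 c * s.2⟩ :: l) = PushoutI.base φ c * lprod φ (s :: l) := by
  simp [base_eq s.1, mul_assoc]

section Injective

variable (hφ : ∀ i, Function.Injective (φ i))
include hφ

theorem of_mem_range_base {i : Bool} {g : F i}
    (h : (PushoutI.of i g : PushoutI φ) ∈ (PushoutI.base φ).range) : g ∈ (φ i).range := by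
  obtain ⟨c, hc⟩ := h
  rw [base_eq i] at hc
  exact ⟨c, PushoutI.of_injective hφ i hc⟩

/-- This is the normal form theorem, applied to the reduced word with the given syllables. Later
uniqueness arguments exhibit a nonempty reduced list whose value would lie in `C`. -/
theorem Red.eq_nil {l : List (Σ i, F i)} (h : Red φ l)
    (hl : lprod φ l ∈ (PushoutI.base φ).range) : l = [] := by
  let w : CoprodI.Word F := ⟨l, fun s hs h1 => h.2 s hs (h1 ▸ one_mem _), by
    have := h.1
    rwa [List.isChain_map] at this⟩
  have hw : PushoutI.Reduced φ w := h.2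
  have hp : (PushoutI.ofCoprodI w.prod : PushoutI φ) = lprod φ l := by
    simp [CoprodI.Word.prod, lprod, map_list_prod, w, Function.comp_def]
  exact congrArg CoprodI.Word.toList (hw.eq_empty_of_mem_range hφ (hp ▸ hl))

/-- The first syllables of two reduced forms of the same element agree up to `C`. -/
theorem Red.head_eq {s t : Σ i, F i} {p q : List (Σ i, F i)} (hp : Red φ (s :: p))
    (hq : Red φ (t :: q)) {c d : C}
    (h : lprod φ (s :: p) * PushoutI.base φ d = PushoutI.base φ c * lprod φ (t :: q)) :
    s.1 = t.1 ∧ ∃ c', (PushoutI.of t.1 t.2 : PushoutI φ) =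
      (PushoutI.base φ c)⁻¹ * PushoutI.of s.1 s.2 * PushoutI.base φ c' := by
  have key : (lprod φ p)⁻¹ * (PushoutI.of s.1 s.2⁻¹ * PushoutI.base φ c * PushoutI.of t.1 t.2)
      * lprod φ q = PushoutI.base φ d := by
    rw [lprod_cons, lprod_cons] at h
    rw [map_inv]
    calc _ = (lprod φ p)⁻¹ * (PushoutI.of s.1 s.2)⁻¹ *
        (PushoutI.base φ c * (PushoutI.of t.1 t.2 * lprod φ q)) := by group
      _ = _ := by rw [← h]; group
  obtain ⟨i, a⟩ := s
  obtain ⟨j, b⟩ := t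
  have hij : i = j := by
    -- If the first factors differ, nothing cancels: `p⁻¹ s⁻¹ (c t) q` is a nonempty reduced list,
    -- and by `key` its value is `d ∈ C`.
    by_contra hne
    have hred : Red φ (linv (⟨i, a⟩ :: p) ++ (⟨j, φ j c * b⟩ :: q)) := by
      refine ⟨?_, noBase_append.2 ⟨noBase_linv.2 hp.2, (hq.absorb c).2⟩⟩
      rw [List.map_append, sides_linv, List.isChain_append]
      refine ⟨?_, hq.1, ?_⟩
      · rw [List.isChain_reverse]
        exact hp.1.imp fun a b h => h.symm
      · simpa using hne
    have := hred.eq_nil hφ ⟨d, by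
      rw [← key]
      simp [base_eq j, mul_assoc]⟩
    simp at this
  subst hij
  refine ⟨rfl, ?_⟩
  -- Otherwise `p⁻¹ (a⁻¹ c b) q` would be a nonempty reduced list with value `d`.
  have hmem : a⁻¹ * φ i c * b ∈ (φ i).range := by
    by_contra hnm
    have hred : Red φ (linv p ++ (⟨i, a⁻¹ * φ i c * b⟩ :: q)) := by
      refine ⟨?_, noBase_append.2 ⟨noBase_linv.2 hp.tail.2, ?_⟩⟩
      · rw [List.map_append, sides_linv, List.map_cons, List.isChain_split]
        refine ⟨?_, hq.1⟩
        have := hp.1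
        rw [List.map_cons] at this
        rw [← List.reverse_cons, List.isChain_reverse]
        exact this.imp fun a b h => h.symm
      · rw [noBase_cons]
        exact ⟨hnm, hq.tail.2⟩
    have := hred.eq_nil hφ ⟨d, by
      rw [← key]
      simp [base_eq i, mul_assoc]⟩
    simp at this
  obtain ⟨c', hc'⟩ := hmem
  refine ⟨c', ?_⟩
  rw [base_eq i c', hc']
  simp [base_eq i, mul_assoc]

/-- Reduced forms of the same element have the same sequence of factors. -/
theorem Red.sides_eq {p q : List (Σ i, F i)} (hp : Red φ p) (hq : Red φ q) {c d : C}
    (h : lprod φ p * PushoutI.base φ d = PushoutI.base φ c * lprod φ q) :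
    p.map Sigma.fst = q.map Sigma.fst := by
  induction p generalizing q c with
  | nil =>
    rw [hq.eq_nil hφ ⟨c⁻¹ * d, by
      rw [map_mul, map_inv, inv_mul_eq_iff_eq_mul, ← h, lprod_nil, one_mul]⟩]
  | cons s p ih =>
    match q with
    | [] =>
      have := hp.eq_nil hφ ⟨c * d⁻¹, by
        rw [map_mul, map_inv, mul_inv_eq_iff_eq_mul, h, lprod_nil, mul_one]⟩
      simp at this
    | t :: q =>
      obtain ⟨h1, c', hc'⟩ := hp.head_eq hφ hq h
      rw [List.map_cons, List.map_cons, h1, ih (c := c') hp.tail hq.tail]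
      rw [lprod_cons, lprod_cons, hc'] at h
      refine mul_left_cancel (a := PushoutI.of s.1 s.2) ?_
      rw [← mul_assoc, h]
      group

theorem Red.sides_eq_of_lprod_eq {p q : List (Σ i, F i)} (hp : Red φ p) (hq : Red φ q)
    (h : lprod φ p = lprod φ q) : p.map Sigma.fst = q.map Sigma.fst :=
  hp.sides_eq hφ hq (c := 1) (d := 1) (by simpa using h)

end Injective

end Reduced

end AmalgCSP

/-! ## Conjugacy in the amalgamated product -/

namespace AmalgCSP

open Monoid

section Conjugacy

variable {F : Bool → Type*} [∀ i, Group (F i)] {C : Type*} [Group C] {φ : ∀ i, C →* F i}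

theorem lprod_surjective : Function.Surjective (lprod φ) := by
  intro g
  induction g using PushoutI.induction_on with
  | of i g => exact ⟨[⟨i, g⟩], by simp⟩
  | base c => exact ⟨[⟨false, φ false c⟩], by simp [base_eq false]⟩
  | mul a b ha hb =>
    obtain ⟨l, rfl⟩ := ha
    obtain ⟨m, rfl⟩ := hb
    exact ⟨l ++ m, by simp⟩

/-- Either two neighbours lie in one factor and merge, or a syllable lies in `C` and is absorbed by
a neighbour. The latter requires a neighbour, hence the bound on the length. -/
theorem exists_shorter {l : List (Σ i, F i)} (h2 : 2 ≤ l.length) (h : ¬ Red φ l) :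
    ∃ m : List (Σ i, F i), m.length < l.length ∧ lprod φ m = lprod φ l := by
  induction l with
  | nil => simp at h2
  | cons s l ih =>
    match l, ih with
    | [], _ => simp at h2
    | ⟨j, b⟩ :: r, ih =>
      obtain ⟨i, a⟩ := s
      by_cases hij : i = j
      · subst hij
        exact ⟨⟨i, a * b⟩ :: r, by simp, by simp [mul_assoc]⟩
      by_cases ha : a ∈ (φ i).range
      · obtain ⟨c, rfl⟩ := ha
        exact ⟨⟨j, φ j c * b⟩ :: r, by simp, by simp [mul_assoc, ← base_eq]⟩
      by_cases hb : b ∈ (φ j).range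
      · obtain ⟨c, rfl⟩ := hb
        exact ⟨⟨i, a * φ i c⟩ :: r, by simp, by simp [mul_assoc, ← base_eq]⟩
      have hr : ¬ Red φ (⟨j, b⟩ :: r) := fun hr =>
        h ⟨by simpa [hij] using hr.1, noBase_cons.2 ⟨ha, hr.2⟩⟩
      match r with
      | [] => exact absurd ⟨by simp, by simpa using hb⟩ hr
      | t :: r =>
        obtain ⟨m, hm, hm'⟩ := ih (by simp) hr
        exact ⟨⟨i, a⟩ :: m, by simpa using hm, by rw [lprod_cons, lprod_cons, hm']⟩

theorem exists_red (g : PushoutI φ) :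
    ∃ (c : C) (l : List (Σ i, F i)), Red φ l ∧ g = PushoutI.base φ c * lprod φ l := by
  classical
  -- An expression of minimal length is reduced. The prefix `c` takes up a lone syllable that lies
  -- in `C`.
  have hex : ∃ m, ∃ (c : C) (l : List (Σ i, F i)), l.length = m ∧
      g = PushoutI.base φ c * lprod φ l := by
    obtain ⟨l, rfl⟩ := lprod_surjective g
    exact ⟨_, 1, l, rfl, by simp⟩
  obtain ⟨c, l, hl, hg⟩ := Nat.find_spec hex
  by_contra hcon
  have hr : ¬ Red φ l := fun h => hcon ⟨c, l, h, hg⟩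
  obtain ⟨d, m, hm, hm'⟩ : ∃ (d : C) (m : List (Σ i, F i)), m.length < l.length ∧
      g = PushoutI.base φ d * lprod φ m := by
    match l with
    | [] => exact absurd ⟨by simp, by simp⟩ hr
    | [s] =>
      have hs : s.2 ∈ (φ s.1).range := by
        by_contra hs
        exact hr ⟨by simp, by simpa using hs⟩
      obtain ⟨d, hd⟩ := hs
      exact ⟨c * d, [], by simp, by rw [hg]; simp [base_eq s.1, hd]⟩
    | s :: t :: l =>
      obtain ⟨m, hm, hm'⟩ := exists_shorter (by simp) hr
      exact ⟨c, m, hm, by rw [hm', hg]⟩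
  exact Nat.find_min hex (hl ▸ hm) ⟨d, m, rfl, hm'⟩

/-- Every element is conjugate to a syllable or to a cyclically reduced element. -/
theorem exists_conj_syllable_or_cycRed (g : PushoutI φ) :
    ∃ l : List (Σ i, F i), IsConj g (lprod φ l) ∧ ((∃ s, l = [s]) ∨ CycRed φ l) := by
  classical
  -- The list has minimal length among all lists whose values are conjugate to `g`.
  have hex : ∃ m, ∃ l : List (Σ i, F i), l.length = m ∧ IsConj g (lprod φ l) := by
    obtain ⟨l, rfl⟩ := lprod_surjective g
    exact ⟨_, l, rfl, IsConj.refl _⟩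
  obtain ⟨l, hl, hg⟩ := Nat.find_spec hex
  have hmin : ∀ m : List (Σ i, F i), m.length < l.length → ¬ IsConj g (lprod φ m) :=
    fun m hm hc => Nat.find_min hex (hl ▸ hm) ⟨m, rfl, hc⟩
  clear hl
  by_cases h2 : 2 ≤ l.length
  · have hr : Red φ l := by
      by_contra hr
      obtain ⟨m, hm, hm'⟩ := exists_shorter h2 hr
      exact hmin m hm (hm' ▸ hg)
    refine ⟨l, hg, Or.inr ⟨by rintro rfl; simp at h2, ?_, noBase_append.2 ⟨hr.2, hr.2⟩⟩⟩
    rw [List.map_append, List.isChain_append]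
    refine ⟨hr.1, hr.1, ?_⟩
    obtain ⟨s, m, t, rfl⟩ : ∃ s m t, l = s :: (m ++ [t]) := by
      match l with
      | [] => simp at h2
      | [s] => simp at h2
      | s :: t :: l =>
        exact ⟨s, (t :: l).dropLast, (t :: l).getLast (by simp), by
          rw [List.dropLast_append_getLast]⟩
    obtain ⟨i, a⟩ := s
    obtain ⟨j, b⟩ := t
    intro p hp q hq hpq
    have hp' : j = p := by
      rw [List.map_cons, List.map_append, List.map_singleton, ← List.cons_append,
        List.getLast?_concat] at hp
      simpa using hp
    have hq' : i = q := by simpa using hq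
    subst hp' hq' hpq
    -- If both ends lie in one factor, conjugation by the last syllable merges it with the first and
    -- shortens the list.
    refine hmin (⟨j, b * a⟩ :: m) (by simp) (hg.trans ?_)
    rw [isConj_iff]
    exact ⟨PushoutI.of j b, by simp [mul_assoc]⟩
  · match l with
    | [] => exact ⟨[⟨false, 1⟩], by simpa using hg, Or.inl ⟨_, rfl⟩⟩
    | [s] => exact ⟨[s], hg, Or.inl ⟨_, rfl⟩⟩
    | s :: t :: l => simp at h2

theorem mem_genCenter {H : Type*} [Group H] {K : Subgroup H} {a g : H} (ha : a ∈ K) (h1 : a ≠ 1)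
    (hg : g ∉ K) (h : g⁻¹ * a * g ∈ K) : a ∈ genCenter K := by
  simp only [genCenter, Set.mem_iUnion]
  refine ⟨g, ⟨?_, hg⟩, ?_, ha⟩
  · intro hbot
    have : g⁻¹ * a * g ∈ K ⊓ conjSub K g := ⟨h, a, ha, by simp⟩
    rw [hbot, Subgroup.mem_bot] at this
    apply h1
    have h2 : a = g * (g⁻¹ * a * g) * g⁻¹ := by group
    rw [h2, this]
    simp
  · exact ⟨g⁻¹ * a * g, h, by simp [mul_assoc]⟩

theorem exists_of_mem_genCenter {H : Type*} [Group H] {K : Subgroup H} {a : H}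
    (h : a ∈ genCenter K) : ∃ g, g ∉ K ∧ g⁻¹ * a * g ∈ K := by
  simp only [genCenter, Set.mem_iUnion] at h
  obtain ⟨g, ⟨-, hg⟩, ⟨b, hb, hb'⟩, -⟩ := h
  refine ⟨g, hg, ?_⟩
  rw [← hb']
  simpa [mul_assoc] using hb

section Injective

variable (hφ : ∀ i, Function.Injective (φ i))
include hφ

/-- A regular nontrivial element of `C` can be conjugated into `C` only by elements of `C`. -/
theorem mem_base_of_conj_mem_base {u : C} (hu : u ≠ 1)
    (hZ : ∀ i, φ i u ∉ genCenter (φ i).range) {g : PushoutI φ}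
    (h : g⁻¹ * PushoutI.base φ u * g ∈ (PushoutI.base φ).range) :
    g ∈ (PushoutI.base φ).range := by
  obtain ⟨c, l, hl, rfl⟩ := exists_red g
  match l with
  | [] => exact ⟨c, by simp⟩
  | ⟨i, a⟩ :: l =>
    exfalso
    -- If conjugation by the first syllable `c a ∉ C` kept `u` in `C`, then `u` would lie in the set
    -- `Z` of this factor. Hence `l⁻¹ (u ^ (c a)) l` is reduced and cannot lie in `C`.
    have hnm : a⁻¹ * φ i c⁻¹ * φ i u * φ i c * a ∉ (φ i).range := by
      intro hmem
      refine hZ i (mem_genCenter (g := φ i c * a) ⟨u, rfl⟩ ?_ ?_ ?_)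
      · exact fun h1 => hu (hφ i (h1.trans (map_one _).symm))
      · rw [mul_mem_range_iff]
        exact (noBase_cons.1 hl.2).1
      · convert hmem using 1
        simp [mul_assoc]
    have hred : Red φ (linv l ++ (⟨i, a⁻¹ * φ i c⁻¹ * φ i u * φ i c * a⟩ :: l)) := by
      refine ⟨?_, noBase_append.2 ⟨noBase_linv.2 hl.tail.2, noBase_cons.2 ⟨hnm, hl.tail.2⟩⟩⟩
      rw [List.map_append, sides_linv, List.map_cons]
      exact isChain_ne_reverse_append hl.1
    have := hred.eq_nil hφ (by
      convert h using 1
      simp [base_eq i, mul_assoc])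
    simp at this

/-- If an element of a factor that is not conjugate into `C` is conjugate to an element of a factor
or to a cyclically reduced element, then the latter lies in the same factor, and the elements are
conjugate there. -/
theorem conj_of_syllable {i : Bool} {y : F i} (hy : ∀ c, ¬ IsConj y (φ i c))
    {q : List (Σ i, F i)} (hq : (∃ s, q = [s]) ∨ CycRed φ q)
    (h : IsConj (PushoutI.of i y) (lprod φ q)) :
    ∃ y', q = [⟨i, y'⟩] ∧ IsConj y y' := by
  rw [isConj_iff] at h
  obtain ⟨g, hg⟩ := h
  -- The part of the conjugator in factor `i` is split off, so that the rest `l` does not begin in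
  -- that factor. Then `l⁻¹ (a⁻¹ y a) l` is already reduced.
  obtain ⟨a, l, hl, hal⟩ : ∃ (a : F i) (l : List (Σ i, F i)),
      (Red φ l ∧ (i :: l.map Sigma.fst).IsChain (· ≠ ·)) ∧ g⁻¹ = PushoutI.of i a * lprod φ l := by
    obtain ⟨c, l, hl, hg⟩ := exists_red g⁻¹
    match l with
    | [] => exact ⟨φ i c, [], ⟨hl, by simp⟩, by rw [hg, base_eq i]⟩
    | ⟨j, b⟩ :: l =>
      by_cases hij : i = j
      · subst hij
        exact ⟨φ i c * b, l, ⟨hl.tail, hl.1⟩, by rw [hg]; simp [base_eq i, mul_assoc]⟩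
      · exact ⟨φ i c, ⟨j, b⟩ :: l, ⟨hl, by simpa [hij] using hl.1⟩, by rw [hg, base_eq i]⟩
  have hconj : IsConj y (a⁻¹ * y * a) := by
    rw [isConj_iff]; exact ⟨a⁻¹, by simp⟩
  have hnm : a⁻¹ * y * a ∉ (φ i).range := by
    rintro ⟨c, hc⟩
    exact hy c (hc ▸ hconj)
  have hred : Red φ (linv l ++ (⟨i, a⁻¹ * y * a⟩ :: l)) := by
    refine ⟨?_, noBase_append.2 ⟨noBase_linv.2 hl.1.2, noBase_cons.2 ⟨hnm, hl.1.2⟩⟩⟩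
    rw [List.map_append, sides_linv, List.map_cons]
    exact isChain_ne_reverse_append hl.2
  have hprod : lprod φ (linv l ++ (⟨i, a⁻¹ * y * a⟩ :: l)) = lprod φ q := by
    rw [← hg, ← inv_inv g, hal]
    simp [mul_assoc]
  have hqr : Red φ q := by
    rcases hq with ⟨s, rfl⟩ | hq
    · refine ⟨by simp, noBase_cons.2 ⟨?_, noBase_nil⟩⟩
      rintro ⟨c, hc⟩
      have := hred.eq_nil hφ ⟨c, by rw [hprod]; simp [base_eq s.1, hc]⟩
      simp at this
    · exact hq.red
  have hsides := hred.sides_eq_of_lprod_eq hφ hqr hprod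
  -- For nonempty `l` the list `l⁻¹ (a⁻¹ y a) l` has at least three syllables and begins and ends in
  -- the same factor, so its sequence of factors is neither that of a single syllable nor that of a
  -- cyclically reduced list.
  have hl0 : l = [] := by
    by_contra hne
    rcases hq with ⟨s, rfl⟩ | hq
    · have := congrArg List.length hsides
      have := List.length_pos_iff.2 hne
      simp at *
      omega
    · have h1 := hq.2.1
      rw [List.map_append, ← hsides] at h1
      simp only [List.map_append, sides_linv, List.map_cons] at h1
      exact not_isChain_reverse_append_self (K := l.map Sigma.fst) (M := [i])
        (by simpa using hne) (by simpa using h1)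
  subst hl0
  rcases hq with ⟨⟨j, b⟩, rfl⟩ | hq
  · have hij : i = j := by simpa using hsides
    subst hij
    refine ⟨b, rfl, ?_⟩
    have : a⁻¹ * y * a = b := PushoutI.of_injective hφ i (by simpa using hprod)
    exact this ▸ hconj
  · have := congrArg List.length hsides
    have h2 := hq.two_le
    simp at this
    omega

/-- The list on the left is reduced, has at least two syllables and begins and ends in the same
factor, and the sequence of factors is an invariant of the element. This rules out the case without
cancellation when a cyclically reduced element is conjugated. -/
theorem lprod_ne_of_same_ends {i : Bool} {a b : F i} {n l : List (Σ i, F i)}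
    (ha : a ∉ (φ i).range) (hb : b ∉ (φ i).range) (hn : NoBase φ n)
    (hni : (i :: n.map Sigma.fst ++ [i]).IsChain (· ≠ ·)) (hl : NoBase φ l)
    (hli : (i :: l.map Sigma.fst).IsChain (· ≠ ·))
    {q : List (Σ i, F i)} (hq : (∃ s, q = [s]) ∨ CycRed φ q) :
    lprod φ (linv l ++ (⟨i, a⟩ :: n ++ ⟨i, b⟩ :: l)) ≠ lprod φ q := by
  have hp : Red φ (linv l ++ (⟨i, a⟩ :: n ++ ⟨i, b⟩ :: l)) := by
    refine ⟨?_, ?_⟩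
    · simpa using isChain_ne_conjugate hli hni
    · simp [ha, hb, hn, hl]
  have h2 : 2 ≤ (linv l ++ ((⟨i, a⟩ : Σ i, F i) :: n ++ ⟨i, b⟩ :: l)).length := by
    simp; omega
  have hs : (linv l ++ ((⟨i, a⟩ : Σ i, F i) :: n ++ ⟨i, b⟩ :: l)).map Sigma.fst =
      (i :: l.map Sigma.fst).reverse ++ n.map Sigma.fst ++ (i :: l.map Sigma.fst) := by
    simp
  intro h
  rcases hq with ⟨s, rfl⟩ | hq
  · by_cases hsm : s.2 ∈ (φ s.1).range
    · obtain ⟨c, hc⟩ := hsm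
      have := hp.eq_nil hφ ⟨c, by rw [h]; simp [base_eq s.1, hc]⟩
      simp at this
    · have := hp.sides_eq_of_lprod_eq hφ ⟨by simp, noBase_cons.2 ⟨hsm, noBase_nil⟩⟩ h
      have := congrArg List.length this
      rw [List.length_map, List.length_map, List.length_singleton] at this
      omega
  · have := hp.sides_eq_of_lprod_eq hφ hq.red h
    have h1 := hq.2.1
    rw [List.map_append, ← this, hs] at h1
    exact not_isChain_reverse_append_self (by simp) h1

end Injective

theorem cycRed_rotate_iff {l : List (Σ i, F i)} {s : Σ i, F i} :
    CycRed φ (l ++ [s]) ↔ CycRed φ (s :: l) := by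
  simp only [CycRed, Red, List.map_append, List.map_cons, List.map_nil, List.cons_append,
    List.append_assoc, List.nil_append, noBase_append, noBase_cons, noBase_nil]
  have h1 : ∀ {L : List Bool} {a : Bool}, (L ++ a :: (L ++ [a])).IsChain (· ≠ ·) ↔
      (a :: (L ++ a :: L)).IsChain (· ≠ ·) := by
    intro L a
    have h2 : (a :: (L ++ a :: L)).IsChain (· ≠ ·) ↔
        (a :: (L ++ [a])).IsChain (· ≠ ·) ∧ (a :: L).IsChain (· ≠ ·) :=
      List.isChain_split (l₁ := a :: L)
    rw [List.isChain_split, h2]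
    exact ⟨fun h => ⟨h.2, h.2.left_of_append (l₁ := a :: L)⟩, fun h => ⟨h.1.tail, h.1⟩⟩
  rw [h1]
  simp only [ne_eq, List.append_eq_nil_iff, List.cons_ne_nil, and_false, not_false_eq_true,
    true_and, and_true]
  tauto

theorem CycRed.isChain_cons {l : List (Σ i, F i)} {s : Σ i, F i} (h : CycRed φ (s :: l)) :
    (s.1 :: l.map Sigma.fst ++ [s.1]).IsChain (· ≠ ·) := by
  have := h.2.1
  rw [List.map_append, List.map_cons, List.isChain_split] at this
  exact this.1

/-- If a cyclically reduced element is conjugate to a syllable or to a cyclically reduced element,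
then the latter is conjugate by an element of `C` to a cyclic permutation of the former. -/
theorem exists_rotation_of_conj (hφ : ∀ i, Function.Injective (φ i)) {m : List (Σ i, F i)}
    (hm : CycRed φ m) {q : List (Σ i, F i)} (hq : (∃ s, q = [s]) ∨ CycRed φ q)
    (h : IsConj (lprod φ m) (lprod φ q)) :
    ∃ m', m' ~r m ∧ ∃ d, (PushoutI.base φ d)⁻¹ * lprod φ m' * PushoutI.base φ d = lprod φ q := by
  rw [isConj_iff] at h
  obtain ⟨g, hg⟩ := h
  obtain ⟨c, l, hl, hgl⟩ := exists_red g⁻¹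
  have h' : (PushoutI.base φ c * lprod φ l)⁻¹ * lprod φ m * (PushoutI.base φ c * lprod φ l) =
      lprod φ q := by
    rw [← hgl, ← hg, inv_inv]
  clear hg hgl g
  -- Peel off the first syllable `a'` of the conjugator. The ends of `m` lie in different factors,
  -- so exactly one end lies in the factor of `a'`. If that end is cancelled by `a'` up to `C`,
  -- conjugation by `a'` is a rotation of `m` up to an element of `C`, and the conjugator gets
  -- shorter. If not, the result begins and ends in the same factor, against
  -- `lprod_ne_of_same_ends`.
  induction l generalizing m c with
  | nil => exact ⟨m, List.IsRotated.refl _, c, by simpa using h'⟩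
  | cons s l ih =>
    obtain ⟨i, a⟩ := s
    obtain ⟨a', ha'⟩ : ∃ a', a' = φ i c * a := ⟨_, rfl⟩
    have ham : a' ∉ (φ i).range := by
      rw [ha', mul_mem_range_iff]
      exact (noBase_cons.1 hl.2).1
    have hg : PushoutI.base φ c * lprod φ (⟨i, a⟩ :: l) = PushoutI.of i a' * lprod φ l := by
      rw [ha']; simp [base_eq i, mul_assoc]
    rw [hg] at h'
    match m with
    | [] => exact absurd rfl hm.1
    | ⟨j, b⟩ :: m =>
      by_cases hij : i = j
      · subst hij
        by_cases hmem : a'⁻¹ * b ∈ (φ i).range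
        · obtain ⟨e, he⟩ := hmem
          -- Then `a'⁻¹ (b m) a' = e (m b) e⁻¹`, so the remaining conjugator is `e⁻¹ l`.
          have hb : b = a' * φ i e := by rw [he]; simp
          obtain ⟨m', hm', d, hd⟩ := ih (m := m ++ [⟨i, b⟩]) (cycRed_rotate_iff.2 hm) e⁻¹ hl.tail (by
            rw [← h', hb]
            simp [base_eq i, mul_assoc])
          exact ⟨m', hm'.trans (by simpa using List.isRotated_append (l := m) (l' := [⟨i, b⟩])), d, hd⟩
        · exfalso
          refine lprod_ne_of_same_ends hφ hmem ham (noBase_cons.1 hm.red.2).2 hm.isChain_cons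
            hl.tail.2 hl.1 hq ?_
          rw [← h']
          simp [mul_assoc]
      · obtain ⟨n, t, hnt⟩ : ∃ n t, (⟨j, b⟩ : Σ i, F i) :: m = n ++ [t] :=
          ⟨_, _, (List.dropLast_append_getLast (by simp)).symm⟩
        obtain ⟨k, b'⟩ := t
        have hki : k = i := by
          have h1 := hm.isChain_cons
          match n, hnt with
          | [], hnt =>
            have := hm.two_le
            simp [hnt] at this
          | t :: n, hnt =>
            rw [List.cons_append, List.cons.injEq] at hnt
            rw [hnt.2] at h1
            simp only [List.map_append, List.map_cons, List.map_nil] at h1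
            rw [List.isChain_append] at h1
            have h2 := h1.2.2 k (by
              rw [← List.cons_append, List.getLast?_concat]; rfl) j (by simp)
            cases i <;> cases j <;> cases k <;> simp_all
        subst hki
        rw [hnt] at hm h' ⊢
        have hm2 := cycRed_rotate_iff.1 hm
        by_cases hmem : b' * a' ∈ (φ k).range
        · obtain ⟨e, he⟩ := hmem
          -- Then `a'⁻¹ (n b') a' = e⁻¹ (b' n) e`, so the remaining conjugator is `e l`.
          have hb : a' = b'⁻¹ * φ k e := by rw [he]; simp
          obtain ⟨m', hm', d, hd⟩ := ih (m := ⟨k, b'⟩ :: n) hm2 e hl.tail (by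
            rw [← h', hb]
            simp [base_eq k, mul_assoc])
          exact ⟨m', hm'.trans (by simpa using List.isRotated_append (l := [⟨k, b'⟩]) (l' := n)), d, hd⟩
        · exfalso
          refine lprod_ne_of_same_ends hφ (a := a'⁻¹) (b := b' * a') (by simpa using ham) hmem
            (noBase_cons.1 hm2.red.2).2 hm2.isChain_cons hl.tail.2 hl.1 hq ?_
          rw [← h']
          simp [mul_assoc]

end Conjugacy

end AmalgCSP

/-! ## Conjugation by elements of `C` -/

namespace AmalgCSP

open Monoid

section Twist

variable {F : Bool → Type*} [∀ i, Group (F i)] {C : Type*} [Group C] (φ : ∀ i, C →* F i)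

/-- The subgroup of `C` obtained from `C` by successive operations `K ↦ C ∩ a K a⁻¹`. -/
def descSub (P : List (Σ i, F i)) : Subgroup C :=
  P.foldr (fun s K => capConj φ s.1 s.2 K) ⊤

/-- The elements `c` of `C` such that `p c = l e q` for some `l ∈ K`. -/
def twistSet (K : Subgroup C) (e : C) (p q : List (Σ i, F i)) : Set C :=
  {c | ∃ l ∈ K, lprod φ p * PushoutI.base φ c = PushoutI.base φ (l * e) * lprod φ q}

variable {φ}

theorem mem_capConj {i : Bool} {a : F i} {K : Subgroup C} {c : C} :
    c ∈ capConj φ i a K ↔ ∃ l ∈ K, φ i c = a * φ i l * a⁻¹ := by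
  simp only [capConj, Subgroup.mem_comap, Subgroup.mem_map]
  constructor
  · rintro ⟨_, ⟨l, hl, rfl⟩, h⟩
    exact ⟨l, hl, h.symm⟩
  · rintro ⟨l, hl, h⟩
    exact ⟨_, ⟨l, hl, rfl⟩, h.symm⟩

theorem conj_mem_base_of_mem_descSub {P : List (Σ i, F i)} {c : C} (h : c ∈ descSub φ P) :
    (lprod φ P)⁻¹ * PushoutI.base φ c * lprod φ P ∈ (PushoutI.base φ).range := by
  induction P generalizing c with
  | nil => exact ⟨c, by simp⟩
  | cons s P ih =>
    obtain ⟨l, hl, hc⟩ := mem_capConj.1 h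
    convert ih hl using 1
    rw [base_eq s.1, hc, base_eq s.1 l]
    simp [mul_assoc]

section Injective

variable (hφ : ∀ i, Function.Injective (φ i))
include hφ

theorem twistSet_nil (K : Subgroup C) (e : C) :
    twistSet φ K e [] [] = {c | ∃ l ∈ K, c = l * e} := by
  ext c
  simp only [twistSet, lprod_nil, one_mul, mul_one, Set.mem_ofPred_eq]
  exact exists_congr fun l => and_congr_right fun _ =>
    (PushoutI.base_injective hφ).eq_iff

theorem fst_eq_of_mem_twistSet {s t : Σ i, F i} {p q : List (Σ i, F i)} (hp : Red φ (s :: p))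
    (hq : Red φ (t :: q)) {K : Subgroup C} {e c : C} (h : c ∈ twistSet φ K e (s :: p) (t :: q)) :
    s.1 = t.1 := by
  obtain ⟨l, hl, h⟩ := h
  exact (hp.head_eq hφ hq h).1

/-- Two reduced forms of one element have first syllables that agree up to `C`; hence what remains
after cancelling them, `a⁻¹ l e b`, is an element `c'` of `C`. -/
theorem exists_of_mem_twistSet {i : Bool} {a b : F i} {p q : List (Σ i, F i)}
    (hp : Red φ (⟨i, a⟩ :: p)) (hq : Red φ (⟨i, b⟩ :: q)) {K : Subgroup C} {e c : C}
    (h : c ∈ twistSet φ K e (⟨i, a⟩ :: p) (⟨i, b⟩ :: q)) :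
    ∃ c', ∃ l ∈ K, φ i c' = a⁻¹ * φ i l * (φ i e * b) ∧
      lprod φ p * PushoutI.base φ c = PushoutI.base φ c' * lprod φ q := by
  obtain ⟨l, hl, h⟩ := h
  obtain ⟨-, c', hc'⟩ := hp.head_eq hφ hq h
  have h1 : φ i c' = a⁻¹ * φ i l * (φ i e * b) := by
    apply PushoutI.of_injective hφ i
    simp only [map_mul, map_inv, ← base_eq] at hc' ⊢
    rw [hc']
    group
  refine ⟨c', l, hl, h1, ?_⟩
  rw [base_eq i c', h1]
  simp only [lprod_cons, map_mul, map_inv, ← base_eq] at h ⊢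
  rw [mul_assoc (PushoutI.of i a)⁻¹, mul_assoc (PushoutI.of i a)⁻¹, eq_inv_mul_iff_mul_eq,
    ← mul_assoc, h]
  group

/-- The elements `a⁻¹ l e b` with `l ∈ K` that lie in `C` form a right coset of `C ∩ a⁻¹ K a`, and
any one of them can serve as representative `e'`. This is the recursion behind `twist`. -/
theorem twistSet_cons {i : Bool} {a b : F i} {p q : List (Σ i, F i)}
    (hp : Red φ (⟨i, a⟩ :: p)) (hq : Red φ (⟨i, b⟩ :: q)) {K : Subgroup C} {e e' l' : C}
    (hl' : l' ∈ K) (he' : φ i e' = a⁻¹ * φ i l' * (φ i e * b)) :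
    twistSet φ K e (⟨i, a⟩ :: p) (⟨i, b⟩ :: q) = twistSet φ (capConj φ i a⁻¹ K) e' p q := by
  ext c
  constructor
  · intro h
    obtain ⟨c', l, hl, h1, h2⟩ := exists_of_mem_twistSet hφ hp hq h
    refine ⟨c' * e'⁻¹, mem_capConj.2 ⟨l * l'⁻¹, mul_mem hl (inv_mem hl'), ?_⟩, ?_⟩
    · rw [map_mul, map_inv, h1, he', map_mul, map_inv]
      group
    · rw [h2]; simp
  · rintro ⟨l, hl, h⟩
    obtain ⟨l1, hl1, h1⟩ := mem_capConj.1 hl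
    refine ⟨l1 * l', mul_mem hl1 hl', ?_⟩
    rw [lprod_cons, mul_assoc, h, base_eq i, map_mul, h1, he']
    simp only [lprod_cons, map_mul, map_inv, ← base_eq]
    group

end Injective

/-- The subgroup lies in `C ∩ C ^ m`. Being cyclically reduced, `m` is not in `C`, so regularity
keeps it out of the generalized normalizer and the intersection is trivial. -/
theorem descSub_linv_eq_bot (hφ : ∀ i, Function.Injective (φ i)) {m : List (Σ i, F i)}
    (hm : CycRed φ m) (hr : IsRegular φ (lprod φ m)) : descSub φ (linv m) = ⊥ := by
  rw [Subgroup.eq_bot_iff_forall]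
  intro c hc
  have h1 := conj_mem_base_of_mem_descSub hc
  have h2 : lprod φ m ∉ (PushoutI.base φ).range := fun h => hm.1 (hm.red.eq_nil hφ h)
  have h3 : lprod φ m ∉ genNormalizer (PushoutI.base φ).range := fun h => hr (Or.inl ⟨h, h2⟩)
  simp only [genNormalizer, ne_eq, Set.mem_ofPred_eq, not_not] at h3
  have h4 : PushoutI.base φ c ∈ (PushoutI.base φ).range ⊓ conjSub (PushoutI.base φ).range
      (lprod φ m) := by
    refine ⟨⟨c, rfl⟩, _, h1, ?_⟩
    simp [mul_assoc]
  rw [h3, Subgroup.mem_bot] at h4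
  exact PushoutI.base_injective hφ (h4.trans (map_one _).symm)

end Twist

/-! ## Words -/

section Words

variable {H ι : Type*} [Group H] (x : ι → H)

@[simp] theorem eval_nil : eval x [] = 1 := by simp [eval]

@[simp] theorem eval_append (v w : List (ι × Bool)) :
    eval x (v ++ w) = eval x v * eval x w := by
  simp only [eval, ← map_mul, FreeGroup.mul_mk]

theorem eval_cons (a : ι × Bool) (w : List (ι × Bool)) :
    eval x (a :: w) = eval x [a] * eval x w := by
  rw [← eval_append, List.singleton_append]

theorem eval_singleton (a : ι × Bool) : eval x [a] = bif a.2 then x a.1 else (x a.1)⁻¹ := by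
  simp [eval]

theorem eval_invRev (w : List (ι × Bool)) : eval x (FreeGroup.invRev w) = (eval x w)⁻¹ := by
  simp only [eval, ← FreeGroup.inv_mk, map_inv]

theorem primrec_invRev {ι : Type*} [Primcodable ι] :
    Primrec (FreeGroup.invRev : List (ι × Bool) → List (ι × Bool)) := by
  refine Primrec.list_reverse.comp (Primrec.list_map Primrec.id ?_)
  exact (Primrec.fst.comp Primrec.snd).pair (Primrec.not.comp (Primrec.snd.comp Primrec.snd))

end Words

/-! ## Algorithms on lists of syllables -/

/-- A syllable given by a word: the factor and a word in a common alphabet. -/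
abbrev Syl (ι : Type) : Type := Bool × Word ι

section Syllables

variable {F : Bool → Type*} [∀ i, Group (F i)] {C : Type*} [Group C] (φ : ∀ i, C →* F i)
  {ι : Type} (y : ∀ i, ι → F i)

/-- The value of a syllable. -/
def sval (s : Syl ι) : Σ i, F i := ⟨s.1, eval (y s.1) s.2⟩

/-- The value of a list of syllables in the amalgamated product. -/
def lval (l : List (Syl ι)) : PushoutI φ := lprod φ (l.map (sval y))

/-- The syllables of the inverse element. -/
def sylInv (l : List (Syl ι)) : List (Syl ι) :=
  (l.map fun s => (s.1, FreeGroup.invRev s.2)).reverse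

/-- A word that represents an element of `C` in both factors. -/
def Represents (w : Word ι) (c : C) : Prop := ∀ j, eval (y j) w = φ j c

variable {φ y}

theorem lval_cons (s : Syl ι) (l : List (Syl ι)) :
    lval φ y (s :: l) = PushoutI.of s.1 (eval (y s.1) s.2) * lval φ y l := by
  simp [lval, sval]

theorem lval_append (l m : List (Syl ι)) : lval φ y (l ++ m) = lval φ y l * lval φ y m := by
  simp [lval]

theorem map_sval_sylInv (l : List (Syl ι)) :
    (sylInv l).map (sval y) = linv (l.map (sval y)) := by
  simp only [sylInv, linv, List.map_reverse, List.map_map, Function.comp_def, sval, eval_invRev]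
  rfl

theorem lval_sylInv (l : List (Syl ι)) : lval φ y (sylInv l) = (lval φ y l)⁻¹ := by
  rw [lval, map_sval_sylInv, lprod_linv, lval]

theorem map_fst_sval (l : List (Syl ι)) :
    (l.map (sval y)).map Sigma.fst = l.map Prod.fst := by
  simp [sval, Function.comp_def]

variable [Primcodable ι]

theorem primrec_sylInv : Primrec (sylInv : List (Syl ι) → List (Syl ι)) :=
  Primrec.list_reverse.comp (Primrec.list_map Primrec.id
    ((Primrec.fst.comp Primrec.snd).pair (primrec_invRev.comp (Primrec.snd.comp Primrec.snd))))

variable (φ y) in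
/-- Algorithms for the factors, with words in a common alphabet. -/
structure Effective where
  mem : Syl ι → Option (Word ι)
  mem_computable : Computable mem
  mem_some : ∀ s w, mem s = some w →
    ∃ c, Represents φ y w c ∧ eval (y s.1) s.2 = φ s.1 c
  mem_none : ∀ s, mem s = none → eval (y s.1) s.2 ∉ (φ s.1).range
  isConj : ComputablePred fun t : Bool × Word ι × Word ι =>
    IsConj (eval (y t.1) t.2.1) (eval (y t.1) t.2.2)
  conjBase : ComputablePred fun s : Syl ι => ∃ c, IsConj (eval (y s.1) s.2) (φ s.1 c)
  center : ComputablePred fun s : Syl ι => eval (y s.1) s.2 ∈ genCenter (φ s.1).range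
  pick : Bool × Word ι × List (Syl ι) × Word ι → Option (Word ι)
  pick_computable : Computable pick
  pick_some : ∀ i u P v e, pick (i, u, P, v) = some e →
    ∃ c, Represents φ y e c ∧ ∃ l ∈ descSub φ (P.map (sval y)),
      φ i c = eval (y i) u * φ i l * eval (y i) v
  pick_none : ∀ i u P v, pick (i, u, P, v) = none →
    ∀ c, ∀ l ∈ descSub φ (P.map (sval y)), φ i c ≠ eval (y i) u * φ i l * eval (y i) v
  triv : ComputablePred fun P : List (Syl ι) => descSub φ (P.map (sval y)) = ⊥

namespace Effective

variable (E : Effective φ y)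

theorem mem_eq_none_iff (s : Syl ι) : E.mem s = none ↔ eval (y s.1) s.2 ∉ (φ s.1).range := by
  refine ⟨E.mem_none s, fun h => ?_⟩
  by_contra hne
  obtain ⟨w, hw⟩ := Option.ne_none_iff_exists'.1 hne
  obtain ⟨c, -, hc⟩ := E.mem_some s w hw
  exact h ⟨c, hc.symm⟩

/-- Multiplication of a list of syllables by a syllable from the left. -/
def push (s : Syl ι) (L : List (Syl ι)) : List (Syl ι) :=
  Option.casesOn (motive := fun _ => List (Syl ι)) L.head? [s] fun t =>
    if s.1 = t.1 then (s.1, s.2 ++ t.2) :: L.tail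
    else Option.casesOn (motive := fun _ => List (Syl ι)) (E.mem t) (s :: L) fun c =>
      Option.casesOn (motive := fun _ => List (Syl ι)) L.tail.head? [(s.1, s.2 ++ c)] fun t' =>
        (s.1, s.2 ++ c ++ t'.2) :: L.tail.tail

/-- An equivalent list of syllables that is reduced up to its first syllable. -/
def norm (l : List (Syl ι)) : List (Syl ι) := l.foldr E.push []

theorem push_computable : Computable₂ E.push := by
  let A := Syl ι × List (Syl ι)
  have hs : Computable fun q : ((A × Syl ι) × Word ι) × Syl ι => q.1.1.1.1 :=
    Computable.fst.comp (Computable.fst.comp (Computable.fst.comp Computable.fst))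
  refine Computable.option_casesOn (f := fun q : A => [q.1])
    (o := fun q : A => q.2.head?)
    (g := fun q t => if q.1.1 = t.1 then (q.1.1, q.1.2 ++ t.2) :: q.2.tail
      else Option.casesOn (motive := fun _ => List (Syl ι)) (E.mem t) (q.1 :: q.2) fun c =>
      Option.casesOn (motive := fun _ => List (Syl ι)) q.2.tail.head? [(q.1.1, q.1.2 ++ c)]
        fun t' => (q.1.1, q.1.2 ++ c ++ t'.2) :: q.2.tail.tail) ?_ ?_ ?_
  · exact Primrec.list_head?.to_comp.comp Computable.snd
  · exact Computable.list_cons.comp Computable.fst (Computable.const [])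
  refine Computable.ite_pred (α := A × Syl ι) (p := fun q => q.1.1.1 = q.2.1)
    (ComputablePred.eq (Computable.fst.comp (Computable.fst.comp Computable.fst))
      (Computable.fst.comp Computable.snd)) ?_ ?_
  · exact Computable.list_cons.comp
      ((Computable.fst.comp (Computable.fst.comp Computable.fst)).pair
        (Computable.list_append.comp
          (Computable.snd.comp (Computable.fst.comp Computable.fst))
          (Computable.snd.comp Computable.snd)))
      (Primrec.list_tail.to_comp.comp (Computable.snd.comp Computable.fst))
  refine Computable.option_casesOn (o := fun q : A × Syl ι => E.mem q.2)
    (f := fun q => q.1.1 :: q.1.2)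
    (g := fun q c => Option.casesOn (motive := fun _ => List (Syl ι)) q.1.2.tail.head?
        [(q.1.1.1, q.1.1.2 ++ c)]
        fun t' => (q.1.1.1, q.1.1.2 ++ c ++ t'.2) :: q.1.2.tail.tail) ?_ ?_ ?_
  · exact E.mem_computable.comp Computable.snd
  · exact Computable.list_cons.comp (Computable.fst.comp Computable.fst)
      (Computable.snd.comp Computable.fst)
  refine Computable.option_casesOn (o := fun q : (A × Syl ι) × Word ι => q.1.1.2.tail.head?)
    (f := fun q => [(q.1.1.1.1, q.1.1.1.2 ++ q.2)])
    (g := fun q t' => (q.1.1.1.1, q.1.1.1.2 ++ q.2 ++ t'.2) :: q.1.1.2.tail.tail) ?_ ?_ ?_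
  · exact Primrec.list_head?.to_comp.comp (Primrec.list_tail.to_comp.comp
      (Computable.snd.comp (Computable.fst.comp Computable.fst)))
  · refine Computable.list_cons.comp (Computable.pair ?_ (Computable.list_append.comp ?_ ?_))
      (Computable.const [])
    · exact Computable.fst.comp (Computable.fst.comp (Computable.fst.comp Computable.fst))
    · exact Computable.snd.comp (Computable.fst.comp (Computable.fst.comp Computable.fst))
    · exact Computable.snd
  · refine Computable.list_cons.comp (Computable.pair (Computable.fst.comp hs)
      (Computable.list_append.comp (Computable.list_append.comp (Computable.snd.comp hs) ?_) ?_)) ?_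
    · exact Computable.snd.comp Computable.fst
    · exact Computable.snd.comp Computable.snd
    · exact Primrec.list_tail.to_comp.comp (Primrec.list_tail.to_comp.comp
        (Computable.snd.comp (Computable.fst.comp (Computable.fst.comp Computable.fst))))

theorem norm_computable : Computable E.norm :=
  Computable.list_foldr (h := fun _ q => E.push q.1 q.2) Computable.id (Computable.const [])
    (E.push_computable.comp (Computable.fst.comp Computable.snd)
      (Computable.snd.comp Computable.snd))

/-- The invariant leaves the first syllable free to lie in `C`. That is tested only when a syllable
of the other factor arrives; if it does lie in `C`, it is rewritten in that factor and absorbed. -/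
theorem push_spec (s : Syl ι) {L : List (Syl ι)} (h1 : (L.map Prod.fst).IsChain (· ≠ ·))
    (h2 : NoBase φ (L.tail.map (sval y))) :
    ((E.push s L).map Prod.fst).IsChain (· ≠ ·) ∧ NoBase φ ((E.push s L).tail.map (sval y)) ∧
      lval φ y (E.push s L) = lval φ y (s :: L) := by
  obtain ⟨i, w⟩ := s
  match L with
  | [] => simp [push]
  | ⟨j, v⟩ :: L =>
    by_cases hij : i = j
    · subst hij
      simp only [push, List.head?_cons, if_true, List.tail_cons]
      exact ⟨h1, h2, by simp [lval_cons, mul_assoc]⟩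
    rcases hm : E.mem (j, v) with _ | c
    · simp only [push, List.head?_cons, hij, if_false, hm, List.tail_cons]
      refine ⟨by simpa [hij] using h1, ?_, trivial⟩
      rw [List.map_cons, noBase_cons]
      exact ⟨E.mem_none _ hm, h2⟩
    · obtain ⟨a, ha, ha'⟩ := E.mem_some _ _ hm
      have hc : (PushoutI.of i (eval (y i) c) : PushoutI φ) = PushoutI.of j (eval (y j) v) := by
        have ha'' : eval (y j) v = φ j a := ha'
        rw [ha i, ha'', ← base_eq, ← base_eq]
      match L with
      | [] =>
        simp [push, hij, hm, lval_cons, hc, mul_assoc]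
      | ⟨k, u⟩ :: L =>
        -- There are only two factors, so the syllable behind the absorbed one lies in the factor of
        -- the new one and has to be merged too.
        have hik : k = i := by
          have : j ≠ k := by
            rw [List.map_cons, List.map_cons, List.isChain_cons_cons] at h1
            exact h1.1
          cases i <;> cases j <;> cases k <;> simp_all
        subst hik
        simp only [push, List.head?_cons, hij, if_false, hm, List.tail_cons]
        refine ⟨h1.tail, (noBase_cons.1 h2).2, ?_⟩
        simp [lval_cons, hc, mul_assoc]

theorem norm_spec (l : List (Syl ι)) : ((E.norm l).map Prod.fst).IsChain (· ≠ ·) ∧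
    NoBase φ ((E.norm l).tail.map (sval y)) ∧ lval φ y (E.norm l) = lval φ y l := by
  induction l with
  | nil => simp [norm]
  | cons s l ih =>
    obtain ⟨h1, h2, h3⟩ := E.push_spec s ih.1 ih.2.1
    exact ⟨h1, h2, by rw [lval_cons, ← ih.2.2, ← lval_cons]; exact h3⟩

variable (hφ : ∀ i, Function.Injective (φ i))
include E hφ

/-- A normalized list of at least two syllables is nontrivial: even if its first syllable lies in
`C`, the tail is nonempty and reduced. For shorter lists, triviality in the factor is tested as
conjugacy to `1`; the default syllable for the empty list passes this test. -/
theorem lval_eq_one : ComputablePred fun l : List (Syl ι) => lval φ y l = 1 := by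
  have hc : ComputablePred fun l : List (Syl ι) => (E.norm l).length < 2 ∧
      IsConj (eval (y ((E.norm l).head?.getD (false, [])).1) ((E.norm l).head?.getD (false, [])).2)
        (eval (y ((E.norm l).head?.getD (false, [])).1) []) := by
    refine ComputablePred.and ?_ ?_
    · exact (Primrec.nat_lt.computablePred (α := ℕ × ℕ) (p := fun p => p.1 < p.2)).comp
        ((Computable.list_length.comp E.norm_computable).pair (Computable.const 2))
    · have hh : Computable fun l => (E.norm l).head?.getD (false, []) :=
        Computable.option_getD (Primrec.list_head?.to_comp.comp E.norm_computable)
          (Computable.const _)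
      exact E.isConj.comp ((Computable.fst.comp hh).pair
        ((Computable.snd.comp hh).pair (Computable.const [])))
  refine hc.of_eq fun l => ?_
  obtain ⟨h1, h2, h3⟩ := E.norm_spec l
  rw [← h3]
  generalize E.norm l = L at *
  match L with
  | [] =>
    change (_ ∧ IsConj (eval (y false) []) (eval (y false) [])) ↔ _
    simp [lval]
  | [s] =>
    change (_ ∧ IsConj (eval (y s.1) s.2) (eval (y s.1) [])) ↔ _
    rw [lval_cons, show lval φ y [] = 1 from rfl, mul_one, eval_nil, isConj_one_left,
      List.length_singleton, and_iff_right one_lt_two]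
    exact ⟨fun h => by rw [h, map_one], fun h => PushoutI.of_injective hφ _
      (h.trans (map_one _).symm)⟩
  | s :: t :: L =>
    simp only [List.length_cons]
    refine iff_of_false (by omega) fun h => ?_
    have hr : Red φ ((t :: L).map (sval y)) := ⟨by
      rw [map_fst_sval]
      exact h1.tail, h2⟩
    by_cases hs : eval (y s.1) s.2 ∈ (φ s.1).range
    · obtain ⟨c, hc⟩ := hs
      have := hr.eq_nil hφ ⟨c⁻¹, by
        rw [lval_cons, ← hc, ← base_eq] at h
        rw [map_inv]
        exact inv_eq_of_mul_eq_one_right h⟩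
      simp at this
    · have hr' : Red φ ((s :: t :: L).map (sval y)) := ⟨by rw [map_fst_sval]; exact h1, by
        rw [List.map_cons, noBase_cons]
        exact ⟨hs, h2⟩⟩
      have := hr'.eq_nil hφ ⟨1, by rw [map_one]; exact h.symm⟩
      simp at this

/-- It is decidable whether `p` conjugates `l` to `m`. -/
theorem conj_eq : ComputablePred fun t : List (Syl ι) × List (Syl ι) × List (Syl ι) =>
    (lval φ y t.1)⁻¹ * lval φ y t.2.1 * lval φ y t.1 = lval φ y t.2.2 := by
  have hc : Computable fun t : List (Syl ι) × List (Syl ι) × List (Syl ι) =>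
      sylInv t.1 ++ t.2.1 ++ t.1 ++ sylInv t.2.2 := by
    refine Computable.list_append.comp (Computable.list_append.comp (Computable.list_append.comp
      (primrec_sylInv.to_comp.comp Computable.fst) (Computable.fst.comp Computable.snd))
      Computable.fst) (primrec_sylInv.to_comp.comp (Computable.snd.comp Computable.snd))
  refine ((E.lval_eq_one hφ).comp hc).of_eq fun t => ?_
  simp only [lval_append, lval_sylInv, mul_inv_eq_one]

end Effective

end Syllables

end AmalgCSP

/-! ## Certificates of non-conjugacy -/

namespace AmalgCSP

open Monoid

section Group

variable {F : Bool → Type*} [∀ i, Group (F i)] {C : Type*} [Group C] {φ : ∀ i, C →* F i}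

theorem CycRed.isRotated {l m : List (Σ i, F i)} (hl : CycRed φ l) (h : l ~r m) : CycRed φ m := by
  obtain ⟨j, rfl⟩ := h
  induction j generalizing l with
  | zero => simpa using hl
  | succ j ih =>
    match l with
    | [] => exact absurd rfl hl.1
    | s :: l =>
      rw [List.rotate_cons_succ]
      exact ih (cycRed_rotate_iff.2 hl)

theorem isConj_lprod_of_isRotated {l m : List (Σ i, F i)} (h : l ~r m) :
    IsConj (lprod φ l) (lprod φ m) := by
  obtain ⟨j, hj, rfl⟩ := List.isRotated_iff_mod.1 h
  rw [List.rotate_eq_drop_append_take hj, isConj_iff]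
  refine ⟨(lprod φ (l.take j))⁻¹, ?_⟩
  have hl : lprod φ l = lprod φ (l.take j) * lprod φ (l.drop j) := by
    rw [← lprod_append, List.take_append_drop]
  rw [hl]
  simp

/-- With the element of `C` viewed as a one-syllable list, a rotation of `m` would be conjugate by
an element of `C` into `C`, although it is nonempty and reduced. -/
theorem CycRed.not_isConj_base (hφ : ∀ i, Function.Injective (φ i)) {m : List (Σ i, F i)}
    (hm : CycRed φ m) (c : C) : ¬ IsConj (lprod φ m) (PushoutI.base φ c) := by
  intro h
  obtain ⟨m', hm', d, hd⟩ := exists_rotation_of_conj hφ hm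
    (q := [⟨false, φ false c⟩]) (Or.inl ⟨_, rfl⟩) (by simpa [← base_eq] using h)
  have hc := hm.isRotated hm'.symm
  refine hc.1 (hc.red.eq_nil hφ ⟨d * c * d⁻¹, ?_⟩)
  have : lprod φ m' = PushoutI.base φ d * lprod φ [⟨false, φ false c⟩] * (PushoutI.base φ d)⁻¹ := by
    rw [← hd]; group
  rw [this]
  simp [← base_eq]

end Group

section Syllables

variable {F : Bool → Type*} [∀ i, Group (F i)] {C : Type*} [Group C] {φ : ∀ i, C →* F i}
  {ι : Type} {y : ∀ i, ι → F i}

theorem lval_of_represents {w : Word ι} {c : C} (h : Represents φ y w c) (i : Bool) :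
    lval φ y [(i, w)] = PushoutI.base φ c := by
  simp [lval, sval, h i, ← base_eq]

variable [Primcodable ι]

namespace Effective

variable (E : Effective φ y)

/-- One step of the computation of the elements of `C` that conjugate one list of syllables to
another one. -/
def twistStep (st : List (Syl ι) × Option (List (Syl ι) × Word ι)) (s : Syl ι) :
    List (Syl ι) × Option (List (Syl ι) × Word ι) :=
  (st.1.tail, st.2.bind fun pe => st.1.head?.bind fun t =>
    if s.1 = t.1 then
      (E.pick (s.1, FreeGroup.invRev s.2, pe.1, pe.2 ++ t.2)).map
        fun e => ((s.1, FreeGroup.invRev s.2) :: pe.1, e)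
    else none)

/-- A description of `twistSet` as a coset in `C`, or `none` if it is empty. -/
def twist (p q : List (Syl ι)) : Option (List (Syl ι) × Word ι) :=
  (p.foldl E.twistStep (q, some ([], []))).2

theorem twistStep_computable : Computable₂ E.twistStep := by
  let A := (List (Syl ι) × Option (List (Syl ι) × Word ι)) × Syl ι
  have hinv : Computable fun w : Word ι => FreeGroup.invRev w := primrec_invRev.to_comp
  refine Computable.pair (Primrec.list_tail.to_comp.comp (Computable.fst.comp Computable.fst)) ?_
  refine Computable.option_bind (f := fun a : A => a.1.2)
    (Computable.snd.comp Computable.fst) ?_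
  refine Computable.option_bind (f := fun a : A × List (Syl ι) × Word ι => a.1.1.1.head?)
    (Primrec.list_head?.to_comp.comp
      (Computable.fst.comp (Computable.fst.comp Computable.fst))) ?_
  let D := (A × List (Syl ι) × Word ι) × Syl ι
  have hs : Computable fun d : D => d.1.1.2 :=
    Computable.snd.comp (Computable.fst.comp Computable.fst)
  have hpe : Computable fun d : D => d.1.2 := Computable.snd.comp Computable.fst
  refine Computable.ite_pred (α := D) (p := fun d => d.1.1.2.1 = d.2.1)
    (ComputablePred.eq (Computable.fst.comp hs) (Computable.fst.comp Computable.snd)) ?_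
    (Computable.const none)
  refine Computable.option_map (f := fun d : D =>
    E.pick (d.1.1.2.1, FreeGroup.invRev d.1.1.2.2, d.1.2.1, d.1.2.2 ++ d.2.2)) ?_ ?_
  · refine E.pick_computable.comp ((Computable.fst.comp hs).pair
      ((hinv.comp (Computable.snd.comp hs)).pair ((Computable.fst.comp hpe).pair ?_)))
    exact Computable.list_append.comp (Computable.snd.comp hpe)
      (Computable.snd.comp Computable.snd)
  · have hs' := hs.comp (Computable.fst (α := D) (β := Word ι))
    refine Computable.pair (Computable.list_cons.comp ((Computable.fst.comp hs').pair
      (hinv.comp (Computable.snd.comp hs')))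
      (Computable.fst.comp (hpe.comp Computable.fst))) Computable.snd

theorem twist_computable : Computable₂ E.twist :=
  Computable.snd.comp (Computable.list_foldl (h := fun _ q => E.twistStep q.1 q.2)
    Computable.fst (Computable.snd.pair (Computable.const _))
    (E.twistStep_computable.comp (Computable.fst.comp Computable.snd)
      (Computable.snd.comp Computable.snd)))

theorem foldl_twistStep_none (p q : List (Syl ι)) :
    (p.foldl E.twistStep (q, none)).2 = none := by
  induction p generalizing q with
  | nil => rfl
  | cons s p ih => exact ih q.tail

section Injective

variable (hφ : ∀ i, Function.Injective (φ i))
include hφ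

/-- The state of the fold is the unread part of `q`, a list `P` describing the current subgroup, and
a word `e` for the current coset representative. By `twistSet_cons` each successful step preserves
the solution set; a failed step means that it is empty. Each step puts an inverted syllable of `p`
in front of `P`, which is why `linv p` appears. -/
theorem foldl_twistStep_spec {p q P : List (Syl ι)} {e : Word ι} {c : C}
    (hp : Red φ (p.map (sval y))) (hq : Red φ (q.map (sval y))) (hlen : p.length = q.length)
    (he : Represents φ y e c) :
    ((p.foldl E.twistStep (q, some (P, e))).2 = none →
      twistSet φ (descSub φ (P.map (sval y))) c (p.map (sval y)) (q.map (sval y)) = ∅) ∧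
    ∀ P' e', (p.foldl E.twistStep (q, some (P, e))).2 = some (P', e') →
      P'.map (sval y) = linv (p.map (sval y)) ++ P.map (sval y) ∧
      ∃ c', Represents φ y e' c' ∧
        twistSet φ (descSub φ (P.map (sval y))) c (p.map (sval y)) (q.map (sval y)) =
          {d | ∃ l ∈ descSub φ (P'.map (sval y)), d = l * c'} := by
  induction p generalizing q P e c with
  | nil =>
    obtain rfl : q = [] := List.length_eq_zero_iff.1 hlen.symm
    refine ⟨by simp, ?_⟩
    rintro P' e' h
    obtain ⟨rfl, rfl⟩ : P = P' ∧ e = e' := by simpa using h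
    exact ⟨by simp, c, he, twistSet_nil hφ _ _⟩
  | cons s p ih =>
    match q with
    | [] => simp at hlen
    | t :: q =>
      obtain ⟨i, v⟩ := s
      obtain ⟨j, w⟩ := t
      rw [List.foldl_cons]
      by_cases hij : i = j
      · subst hij
        rcases hpick : E.pick (i, FreeGroup.invRev v, P, e ++ w) with _ | f
        · have hst : E.twistStep ((i, w) :: q, some (P, e)) (i, v) = (q, none) := by
            simp [twistStep, hpick]
          rw [hst, foldl_twistStep_none]
          refine ⟨fun _ => ?_, by simp⟩
          rw [Set.eq_empty_iff_forall_notMem]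
          intro d hd
          obtain ⟨c', l, hl, h1, -⟩ := exists_of_mem_twistSet hφ hp hq hd
          refine E.pick_none _ _ _ _ hpick c' l hl ?_
          rw [h1, eval_invRev, eval_append, he i]
        · have hst : E.twistStep ((i, w) :: q, some (P, e)) (i, v) =
              (q, some ((i, FreeGroup.invRev v) :: P, f)) := by
            simp [twistStep, hpick]
          rw [hst]
          obtain ⟨c', hc', l, hl, h1⟩ := E.pick_some _ _ _ _ _ hpick
          rw [eval_invRev, eval_append, he i] at h1
          have hset := twistSet_cons hφ hp hq hl h1
          have := ih (q := q) (P := (i, FreeGroup.invRev v) :: P) hp.tail hq.tail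
            (by simpa using hlen) hc'
          have hdesc : descSub φ (((i, FreeGroup.invRev v) :: P).map (sval y)) =
              capConj φ i (eval (y i) v)⁻¹ (descSub φ (P.map (sval y))) := by
            rw [← eval_invRev]; rfl
          rw [hdesc, ← hset] at this
          refine ⟨this.1, fun P' e' h => ?_⟩
          obtain ⟨h2, h3⟩ := this.2 P' e' h
          refine ⟨?_, h3⟩
          rw [h2]
          simp [sval, eval_invRev]
      · have hst : E.twistStep ((j, w) :: q, some (P, e)) (i, v) = (q, none) := by
          simp [twistStep, hij]
        rw [hst, foldl_twistStep_none]
        refine ⟨fun _ => ?_, by simp⟩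
        rw [Set.eq_empty_iff_forall_notMem]
        exact fun d hd => hij (fst_eq_of_mem_twistSet hφ hp hq hd)

end Injective

/-- A decidable condition that excludes that an element of `C` conjugates `p` to `q`. -/
def NotTwisted (p q : List (Syl ι)) : Prop :=
  ∀ a ∈ (E.twist p q).toList, descSub φ (a.1.map (sval y)) = ⊥ ∧
    ¬ ((lval φ y [(false, a.2)])⁻¹ * lval φ y p * lval φ y [(false, a.2)] = lval φ y q)

theorem notTwisted_computable (hφ : ∀ i, Function.Injective (φ i)) :
    ComputablePred fun t : List (Syl ι) × List (Syl ι) => E.NotTwisted t.1 t.2 := by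
  refine ComputablePred.forall_mem_list
    (p := fun t : (List (Syl ι) × List (Syl ι)) × List (Syl ι) × Word ι =>
      descSub φ (t.2.1.map (sval y)) = ⊥ ∧
      ¬ ((lval φ y [(false, t.2.2)])⁻¹ * lval φ y t.1.1 * lval φ y [(false, t.2.2)] =
        lval φ y t.1.2)) (ComputablePred.and ?_ (ComputablePred.not ?_))
    (Primrec.optionToList.to_comp.comp (E.twist_computable.comp Computable.fst Computable.snd))
  · exact E.triv.comp (Computable.fst.comp Computable.snd)
  · refine (E.conj_eq hφ).comp (f := fun t : (List (Syl ι) × List (Syl ι)) × List (Syl ι) × Word ι =>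
      ([(false, t.2.2)], t.1.1, t.1.2)) (Computable.pair ?_ Computable.fst)
    exact Computable.list_cons.comp
      ((Computable.const false).pair (Computable.snd.comp Computable.snd)) (Computable.const [])

section Injective

variable (hφ : ∀ i, Function.Injective (φ i))
include hφ

/-- A conjugator `d` solves the relaxed equation `p d = l q`, with `l = d`. Hence the solution set
is nonempty; as its subgroup is trivial, `d` is the candidate that was found to fail. -/
theorem NotTwisted.sound {p q : List (Syl ι)} (h : E.NotTwisted p q)
    (hp : Red φ (p.map (sval y))) (hq : Red φ (q.map (sval y))) (hlen : p.length = q.length)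
    (d : C) : (PushoutI.base φ d)⁻¹ * lval φ y p * PushoutI.base φ d ≠ lval φ y q := by
  intro hd
  have hmem : d ∈ twistSet φ (descSub φ (([] : List (Syl ι)).map (sval y))) 1 (p.map (sval y))
      (q.map (sval y)) := by
    refine ⟨d, Subgroup.mem_top d, ?_⟩
    rw [lval, lval] at hd
    rw [← hd]
    simp [mul_assoc]
  obtain ⟨h1, h2⟩ := E.foldl_twistStep_spec hφ (P := []) (e := []) (c := 1) hp hq hlen
    (fun j => by simp)
  rcases ht : E.twist p q with _ | ⟨P, e⟩
  · rw [h1 ht] at hmem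
    exact hmem
  · obtain ⟨-, c, hc, hset⟩ := h2 P e ht
    obtain ⟨hbot, hne⟩ := h (P, e) (by simp [ht])
    rw [hset, hbot] at hmem
    obtain ⟨l, hl, rfl⟩ := hmem
    rw [Subgroup.mem_bot] at hl
    rw [lval_of_represents hc] at hne
    rw [hl, one_mul] at hd
    exact hne hd

/-- Regularity makes the final subgroup trivial, and a successful candidate would be a conjugator.
-/
theorem notTwisted_of_regular {p q : List (Syl ι)} (hp : CycRed φ (p.map (sval y)))
    (hr : IsRegular φ (lval φ y p)) (hq : Red φ (q.map (sval y))) (hlen : p.length = q.length)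
    (hne : ¬ IsConj (lval φ y p) (lval φ y q)) : E.NotTwisted p q := by
  rintro ⟨P, e⟩ ha
  rw [Option.mem_toList] at ha
  obtain ⟨-, h2⟩ := E.foldl_twistStep_spec hφ (P := []) (e := []) (c := 1) hp.red hq hlen
    (fun j => by simp)
  obtain ⟨h3, -⟩ := h2 P e ha
  refine ⟨?_, fun h => hne ?_⟩
  · rw [h3, List.map_nil, List.append_nil]
    exact descSub_linv_eq_bot hφ hp hr
  · rw [isConj_iff]
    exact ⟨(lval φ y [(false, e)])⁻¹, by simpa using h⟩

end Injective

end Effective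

end Syllables

end AmalgCSP

/-! ### Certificates for the three types of representatives -/

namespace AmalgCSP

open Monoid

section Syllables

variable {F : Bool → Type*} [∀ i, Group (F i)] {C : Type*} [Group C] {φ : ∀ i, C →* F i}
  {ι : Type} {y : ∀ i, ι → F i} [Primcodable ι]

/-- The first syllable of a list. -/
def firstSyl (l : List (Syl ι)) : Syl ι := l.head?.getD (false, [])

theorem firstSyl_computable : Computable (firstSyl : List (Syl ι) → Syl ι) :=
  Computable.option_getD Primrec.list_head?.to_comp (Computable.const _)

theorem length_eq_one_computable : ComputablePred fun l : List (Syl ι) => l.length = 1 :=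
  ComputablePred.eq Computable.list_length (Computable.const 1)

namespace Effective

variable (E : Effective φ y)

/-- The list is a single syllable that lies in `C`. -/
def IsBaseSyl (l : List (Syl ι)) : Prop := l.length = 1 ∧ (E.mem (firstSyl l)).isSome = true

variable (φ y) in
/-- The list is a single syllable that is not conjugate in its factor to an element of `C`. -/
def IsHyperSyl (l : List (Syl ι)) : Prop :=
  l.length = 1 ∧ ¬ ∃ c, IsConj (eval (y (firstSyl l).1) (firstSyl l).2) (φ (firstSyl l).1 c)

variable (φ y) in
/-- The list is a syllable or cyclically reduced. -/
def IsCyc (l : List (Syl ι)) : Prop := CycRed φ (l.map (sval y))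

/-- A word that represents the same element of `C` as the single syllable of the list. -/
def baseWord (l : List (Syl ι)) : Word ι := (E.mem (firstSyl l)).getD []

theorem isBaseSyl_iff {l : List (Syl ι)} : E.IsBaseSyl l ↔
    ∃ s c, l = [s] ∧ Represents φ y (E.baseWord l) c ∧ eval (y s.1) s.2 = φ s.1 c := by
  constructor
  · rintro ⟨h1, h2⟩
    obtain ⟨s, rfl⟩ := List.length_eq_one_iff.1 h1
    obtain ⟨w, hw⟩ := Option.isSome_iff_exists.1 h2
    obtain ⟨c, hc, hc'⟩ := E.mem_some _ _ hw
    exact ⟨s, c, rfl, by simpa [baseWord, hw] using hc, hc'⟩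
  · rintro ⟨s, c, rfl, -, h⟩
    refine ⟨rfl, ?_⟩
    rw [Option.isSome_iff_ne_none]
    exact fun hn => E.mem_none _ hn ⟨c, h.symm⟩

theorem IsBaseSyl.exists_base {l : List (Syl ι)} (h : E.IsBaseSyl l) :
    ∃ c, Represents φ y (E.baseWord l) c ∧ lval φ y l = PushoutI.base φ c := by
  obtain ⟨s, c, rfl, h1, h2⟩ := E.isBaseSyl_iff.1 h
  exact ⟨c, h1, by rw [lval_cons, h2, ← base_eq]; simp [lval]⟩

theorem isBaseSyl_computable : ComputablePred E.IsBaseSyl :=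
  length_eq_one_computable.and (ComputablePred.of_bool
    (Primrec.option_isSome.to_comp.comp (E.mem_computable.comp firstSyl_computable)))

theorem baseWord_computable : Computable E.baseWord :=
  Computable.option_getD (E.mem_computable.comp firstSyl_computable) (Computable.const _)

include E in
theorem isHyperSyl_computable : ComputablePred (IsHyperSyl φ y) :=
  length_eq_one_computable.and (E.conjBase.comp firstSyl_computable).not

theorem isChain_ne_computable :
    ComputablePred fun l : List (Syl ι) => (l.map Prod.fst).IsChain (· ≠ ·) := by
  -- At the last index the right-hand lookup is `none` and the left-hand one is not, so the bound
  -- `l.length` does no harm.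
  have h : ComputablePred fun l : List (Syl ι) => ∀ j < l.length,
      ¬ ((l.map Prod.fst)[j]? = (l.map Prod.fst)[j + 1]?) := by
    have hm : Computable fun t : List (Syl ι) × ℕ => t.1.map Prod.fst :=
      (Primrec.list_map (g := fun (_ : List (Syl ι) × ℕ) (s : Syl ι) => s.1) Primrec.fst
        ((Primrec.fst.comp Primrec.snd).to₂)).to_comp
    refine ComputablePred.forall_lt (p := fun t : List (Syl ι) × ℕ =>
      ¬ ((t.1.map Prod.fst)[t.2]? = (t.1.map Prod.fst)[t.2 + 1]?))
      (ComputablePred.not (ComputablePred.eq ?_ ?_)) Computable.list_length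
    · exact Computable.list_getElem?.comp hm Computable.snd
    · exact Computable.list_getElem?.comp hm (Computable.succ.comp Computable.snd)
  refine h.of_eq fun l => ?_
  rw [List.isChain_iff_getElem]
  constructor
  · intro h j hj
    have := h j (by simp at hj; omega)
    rw [List.getElem?_eq_getElem hj, List.getElem?_eq_getElem (by omega)] at this
    exact fun h' => this (by rw [h'])
  · intro h j hj h'
    by_cases hj' : j + 1 < (l.map Prod.fst).length
    · refine h j hj' ?_
      rw [List.getElem?_eq_getElem hj', List.getElem?_eq_getElem (by omega)] at h'
      exact Option.some.inj h'
    · rw [List.getElem?_eq_none (i := j + 1) (by omega),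
        List.getElem?_eq_getElem (by simpa using hj)] at h'
      simp at h'

include E in
theorem isCyc_computable : ComputablePred (IsCyc φ y) := by
  have hd : Computable fun l : List (Syl ι) => l ++ l :=
    Computable.list_append.comp Computable.id Computable.id
  have h : ComputablePred fun l : List (Syl ι) => ¬ l.length = 0 ∧
      ((l ++ l).map Prod.fst).IsChain (· ≠ ·) ∧ ∀ s ∈ l ++ l, ¬ (E.mem s).isSome = true := by
    refine ComputablePred.and (ComputablePred.not
      (ComputablePred.eq Computable.list_length (Computable.const 0)))
      (ComputablePred.and (isChain_ne_computable.comp hd)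
      (ComputablePred.forall_mem_list (p := fun t : List (Syl ι) × Syl ι =>
        ¬ (E.mem t.2).isSome = true) (ComputablePred.of_bool ?_).not hd))
    exact Primrec.option_isSome.to_comp.comp (E.mem_computable.comp Computable.snd)
  refine h.of_eq fun l => ?_
  rw [IsCyc, CycRed, Red, ← List.map_append, map_fst_sval, List.length_eq_zero_iff, ne_eq,
    List.map_eq_nil_iff, NoBase, List.forall_mem_map]
  simp only [Bool.not_eq_true, Option.isSome_eq_false_iff, Option.isNone_iff_eq_none,
    E.mem_eq_none_iff]
  rfl

/-- A decidable condition that excludes that two lists of syllables are conjugate. -/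
def NotConj (l m : List (Syl ι)) : Prop :=
  (E.IsBaseSyl l ∧ (IsHyperSyl φ y m ∨ IsCyc φ y m)) ∨
  (IsHyperSyl φ y l ∧ (E.IsBaseSyl m ∨ IsCyc φ y m)) ∨
  (IsCyc φ y l ∧ (E.IsBaseSyl m ∨ IsHyperSyl φ y m)) ∨
  (E.IsBaseSyl l ∧ E.IsBaseSyl m ∧
    ((IsConj (eval (y false) (E.baseWord l)) (eval (y false) []) ∧
      ¬ IsConj (eval (y false) (E.baseWord m)) (eval (y false) [])) ∨
    (¬ IsConj (eval (y false) (E.baseWord l)) (eval (y false) []) ∧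
      ¬ eval (y false) (E.baseWord l) ∈ genCenter (φ false).range ∧
      ¬ eval (y true) (E.baseWord l) ∈ genCenter (φ true).range ∧
      ¬ IsConj (eval (y false) (E.baseWord l)) (eval (y false) (E.baseWord m))))) ∨
  (IsHyperSyl φ y l ∧ IsHyperSyl φ y m ∧ ¬ ((firstSyl l).1 = (firstSyl m).1 ∧
      IsConj (eval (y (firstSyl l).1) (firstSyl l).2) (eval (y (firstSyl l).1) (firstSyl m).2))) ∨
  (IsCyc φ y l ∧ IsCyc φ y m ∧ (¬ l.length = m.length ∨
    ∀ j < m.length + 1, E.NotTwisted l (m.drop j ++ m.take j)))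

theorem notConj_computable (hφ : ∀ i, Function.Injective (φ i)) :
    ComputablePred fun t : List (Syl ι) × List (Syl ι) => E.NotConj t.1 t.2 := by
  let A := List (Syl ι) × List (Syl ι)
  have hl : Computable (Prod.fst : A → _) := Computable.fst
  have hm : Computable (Prod.snd : A → _) := Computable.snd
  have hf (b : Bool) : Computable fun _ : A => b := Computable.const b
  have hn : Computable fun _ : A => ([] : Word ι) := Computable.const []
  have hbl : Computable fun t : A => E.baseWord t.1 := E.baseWord_computable.comp hl
  have hbm : Computable fun t : A => E.baseWord t.2 := E.baseWord_computable.comp hm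
  have hB := E.isBaseSyl_computable
  have hH := E.isHyperSyl_computable
  have hC := E.isCyc_computable
  have hsl : Computable fun t : A => firstSyl t.1 := firstSyl_computable.comp hl
  have hsm : Computable fun t : A => firstSyl t.2 := firstSyl_computable.comp hm
  have h1 : ComputablePred fun t : A => IsConj (eval (y false) (E.baseWord t.1))
      (eval (y false) []) := E.isConj.comp ((hf false).pair (hbl.pair hn))
  have h2 : ComputablePred fun t : A => IsConj (eval (y false) (E.baseWord t.2))
      (eval (y false) []) := E.isConj.comp ((hf false).pair (hbm.pair hn))
  have h3 : ComputablePred fun t : A => IsConj (eval (y false) (E.baseWord t.1))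
      (eval (y false) (E.baseWord t.2)) := E.isConj.comp ((hf false).pair (hbl.pair hbm))
  have h4 (b : Bool) : ComputablePred fun t : A =>
      eval (y b) (E.baseWord t.1) ∈ genCenter (φ b).range := E.center.comp ((hf b).pair hbl)
  have h5 : ComputablePred fun t : A => IsConj (eval (y (firstSyl t.1).1) (firstSyl t.1).2)
      (eval (y (firstSyl t.1).1) (firstSyl t.2).2) :=
    E.isConj.comp ((Computable.fst.comp hsl).pair
      ((Computable.snd.comp hsl).pair (Computable.snd.comp hsm)))
  have h6 : ComputablePred fun t : A => (firstSyl t.1).1 = (firstSyl t.2).1 :=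
    ComputablePred.eq (Computable.fst.comp hsl) (Computable.fst.comp hsm)
  have h7 : ComputablePred fun t : A => t.1.length = t.2.length :=
    ComputablePred.eq (Computable.list_length.comp hl) (Computable.list_length.comp hm)
  have h8 : ComputablePred fun t : A =>
      ∀ j < t.2.length + 1, E.NotTwisted t.1 (t.2.drop j ++ t.2.take j) := by
    refine ComputablePred.forall_lt
      (p := fun s : A × ℕ => E.NotTwisted s.1.1 (s.1.2.drop s.2 ++ s.1.2.take s.2)) ?_
      (Computable.succ.comp (Computable.list_length.comp hm))
    refine (E.notTwisted_computable hφ).comp ((Computable.fst.comp Computable.fst).pair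
      (Computable.list_append.comp ?_ ?_))
    · exact Primrec.list_drop.to_comp.comp Computable.snd (Computable.snd.comp Computable.fst)
    · exact Primrec.list_take.to_comp.comp Computable.snd (Computable.snd.comp Computable.fst)
  exact ((hB.comp hl).and ((hH.comp hm).or (hC.comp hm))).or
    (((hH.comp hl).and ((hB.comp hm).or (hC.comp hm))).or
    (((hC.comp hl).and ((hB.comp hm).or (hH.comp hm))).or
    (((hB.comp hl).and ((hB.comp hm).and ((h1.and h2.not).or
      (h1.not.and ((h4 false).not.and ((h4 true).not.and h3.not)))))).or
    (((hH.comp hl).and ((hH.comp hm).and (h6.and h5).not)).or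
    ((hC.comp hl).and ((hC.comp hm).and (h7.not.or h8)))))))

section Injective

variable (hφ : ∀ i, Function.Injective (φ i))
include hφ

omit [Primcodable ι] in
theorem IsHyperSyl.conj {l m : List (Syl ι)} (hl : IsHyperSyl φ y l)
    (hm : m.length = 1 ∨ IsCyc φ y m) (h : IsConj (lval φ y l) (lval φ y m)) :
    m.length = 1 ∧ (firstSyl l).1 = (firstSyl m).1 ∧
      IsConj (eval (y (firstSyl l).1) (firstSyl l).2)
        (eval (y (firstSyl l).1) (firstSyl m).2) := by
  obtain ⟨h1, h2⟩ := hl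
  obtain ⟨⟨i, v⟩, rfl⟩ := List.length_eq_one_iff.1 h1
  obtain ⟨y', hy, hy'⟩ := conj_of_syllable hφ (i := i) (y := eval (y i) v)
    (fun c hc => h2 ⟨c, hc⟩) (q := m.map (sval y))
    (hm.imp (fun hm => by
      obtain ⟨t, rfl⟩ := List.length_eq_one_iff.1 hm
      exact ⟨_, rfl⟩) id)
    (by simpa [lval, sval] using h)
  obtain ⟨⟨j, w⟩, rfl⟩ : ∃ t, m = [t] := by
    have := congrArg List.length hy
    rw [List.length_map, List.length_singleton] at this
    exact List.length_eq_one_iff.1 this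
  simp only [sval, List.map_cons, List.map_nil, List.cons.injEq, Sigma.mk.injEq, and_true] at hy
  obtain ⟨rfl, hy⟩ := hy
  obtain rfl := eq_of_heq hy
  exact ⟨rfl, rfl, hy'⟩

theorem not_isConj_base_hyper {l m : List (Syl ι)} (hl : E.IsBaseSyl l)
    (hm : IsHyperSyl φ y m) : ¬ IsConj (lval φ y l) (lval φ y m) := by
  intro h
  obtain ⟨h1, h2, h3⟩ := hm.conj hφ (Or.inl hl.1) h.symm
  obtain ⟨s, c, rfl, -, hs⟩ := E.isBaseSyl_iff.1 hl
  obtain ⟨t, rfl⟩ := List.length_eq_one_iff.1 hm.1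
  obtain ⟨i, v⟩ := s
  obtain ⟨j, w⟩ := t
  obtain rfl : j = i := h2
  refine hm.2 ⟨c, ?_⟩
  have hs' : eval (y j) v = φ j c := hs
  change IsConj (eval (y j) w) (φ j c)
  rw [← hs']
  exact h3

theorem not_isConj_base_cyc {l m : List (Syl ι)} (hl : E.IsBaseSyl l)
    (hm : IsCyc φ y m) : ¬ IsConj (lval φ y l) (lval φ y m) := by
  intro h
  obtain ⟨c, -, hc⟩ := hl.exists_base
  exact hm.not_isConj_base hφ c (hc ▸ h.symm)

omit [Primcodable ι] in
theorem not_isConj_hyper_cyc {l m : List (Syl ι)} (hl : IsHyperSyl φ y l)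
    (hm : IsCyc φ y m) : ¬ IsConj (lval φ y l) (lval φ y m) := by
  intro h
  obtain ⟨h1, -⟩ := hl.conj hφ (Or.inr hm) h
  have := hm.two_le
  rw [List.length_map] at this
  omega

/-- Representatives of different types are separated by the normal form. For two elements of `C`,
the conditions on `genCenter` force a conjugator into `C`, so a test in one factor suffices. For two
cyclically reduced lists, every rotation of `m` has been excluded. -/
theorem NotConj.sound {l m : List (Syl ι)} (h : E.NotConj l m) :
    ¬ IsConj (lval φ y l) (lval φ y m) := by
  intro hc
  rcases h with ⟨hl, hm | hm⟩ | ⟨hl, hm | hm⟩ | ⟨hl, hm | hm⟩ | ⟨hl, hm, h⟩ | ⟨hl, hm, h⟩ |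
    ⟨hl, hm, h⟩
  · exact E.not_isConj_base_hyper hφ hl hm hc
  · exact E.not_isConj_base_cyc hφ hl hm hc
  · exact E.not_isConj_base_hyper hφ hm hl hc.symm
  · exact not_isConj_hyper_cyc hφ hl hm hc
  · exact E.not_isConj_base_cyc hφ hm hl hc.symm
  · exact not_isConj_hyper_cyc hφ hm hl hc.symm
  · obtain ⟨c, hrc, hlc⟩ := hl.exists_base
    obtain ⟨d, hrd, hmd⟩ := hm.exists_base
    rw [hlc, hmd] at hc
    rw [hrc, hrc, hrd, eval_nil, isConj_one_left, isConj_one_left] at h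
    rcases h with ⟨h1, h2⟩ | ⟨h1, h2, h3, h4⟩
    · have hc1 : c = 1 := hφ false (h1.trans (map_one _).symm)
      rw [hc1, map_one, isConj_one_right] at hc
      have hd1 : d = 1 := PushoutI.base_injective hφ (hc.trans (map_one _).symm)
      exact h2 (by rw [hd1, map_one])
    · rw [isConj_iff] at hc
      obtain ⟨g, hg⟩ := hc
      have hc1 : c ≠ 1 := by
        rintro rfl
        exact h1 (map_one _)
      obtain ⟨b, hb⟩ := mem_base_of_conj_mem_base hφ hc1
        (fun i => by cases i <;> assumption) (g := g⁻¹) ⟨d, by rw [← hg]; simp⟩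
      rw [← inv_inv g, ← hb, inv_inv, ← map_inv, ← map_mul, ← map_mul] at hg
      refine h4 (isConj_iff.2 ⟨φ false b⁻¹, ?_⟩)
      rw [← PushoutI.base_injective hφ hg]
      simp
  · exact h (hl.conj hφ (Or.inl hm.1) hc).2
  · obtain ⟨m', hm', d, hd⟩ := exists_rotation_of_conj hφ hm (Or.inr hl) hc.symm
    -- The shift satisfies only `j ≤ m.length`, which accounts for the bound `m.length + 1` in
    -- `NotConj`.
    obtain ⟨j, hj, rfl⟩ := List.isRotated_iff_mod.1 hm'.symm
    have hred := (CycRed.isRotated hm hm'.symm).red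
    have hlen : l.length = m.length := by
      have := congrArg List.length (hred.sides_eq hφ hl.red (c := d) (d := d) (by
        rw [← hd]; group))
      simpa using this.symm
    rw [List.length_map] at hj
    rw [List.rotate_eq_drop_append_take (by simpa using hj), ← List.map_drop, ← List.map_take,
      ← List.map_append] at hred hd
    refine (h.resolve_left (not_not.2 hlen) j (by omega)).sound E hφ hl.red hred ?_ d⁻¹ ?_
    · simp; omega
    · rw [lval, ← hd, lval]
      simp [mul_assoc]

/-- Regularity enters twice: an element of `C` outside `Z` of the amalgam is, if nontrivial, outside
`Z` of each factor, and for a cyclically reduced list the twist subgroup is trivial. The other cases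
hold because conjugacy in a factor, or by rotation, is conjugacy in the amalgam. -/
theorem notConj_of_regular {l m : List (Syl ι)}
    (hl : E.IsBaseSyl l ∨ IsHyperSyl φ y l ∨ IsCyc φ y l)
    (hm : E.IsBaseSyl m ∨ IsHyperSyl φ y m ∨ IsCyc φ y m)
    (hr : IsRegular φ (lval φ y l)) (h : ¬ IsConj (lval φ y l) (lval φ y m)) :
    E.NotConj l m := by
  rcases hl with hl | hl | hl
  · rcases hm with hm | hm
    · refine Or.inr (Or.inr (Or.inr (Or.inl ⟨hl, hm, ?_⟩)))
      obtain ⟨c, hrc, hlc⟩ := hl.exists_base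
      obtain ⟨d, hrd, hmd⟩ := hm.exists_base
      rw [hrc, hrc, hrd, eval_nil, isConj_one_left, isConj_one_left]
      rw [hlc, hmd] at h
      have h0 : ∀ c, φ false c = 1 → c = 1 := fun c h1 => hφ false (h1.trans (map_one _).symm)
      by_cases hc : φ false c = 1
      · refine Or.inl ⟨hc, fun hd => h ?_⟩
        rw [h0 c hc, h0 d hd]
      · have hZ : ∀ i, φ i c ∉ genCenter (φ i).range := by
          intro i hi
          obtain ⟨g, hg, e, he⟩ := exists_of_mem_genCenter hi
          refine hr (Or.inr ?_)
          rw [hlc]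
          refine mem_genCenter (g := PushoutI.of i g) ⟨c, rfl⟩ ?_
            (fun h1 => hg (of_mem_range_base hφ h1)) ⟨e, ?_⟩
          · intro h1
            rw [PushoutI.base_injective hφ (h1.trans (map_one _).symm)] at hc
            exact hc (map_one _)
          · rw [base_eq i, he, base_eq i]
            simp
        refine Or.inr ⟨hc, hZ false, hZ true, fun hcd => h ?_⟩
        rw [base_eq false, base_eq false]
        exact MonoidHom.map_isConj _ hcd
    · exact Or.inl ⟨hl, hm⟩
  · rcases hm with hm | hm | hm
    · exact Or.inr (Or.inl ⟨hl, Or.inl hm⟩)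
    · refine Or.inr (Or.inr (Or.inr (Or.inr (Or.inl ⟨hl, hm, ?_⟩))))
      obtain ⟨⟨i, v⟩, rfl⟩ := List.length_eq_one_iff.1 hl.1
      obtain ⟨⟨j, w⟩, rfl⟩ := List.length_eq_one_iff.1 hm.1
      rintro ⟨hij, hc⟩
      obtain rfl : i = j := hij
      refine h ?_
      have hc' : IsConj (eval (y i) v) (eval (y i) w) := hc
      simpa [lval, sval] using MonoidHom.map_isConj (PushoutI.of (φ := φ) i) hc'
    · exact Or.inr (Or.inl ⟨hl, Or.inr hm⟩)
  · rcases hm with hm | hm | hm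
    · exact Or.inr (Or.inr (Or.inl ⟨hl, Or.inl hm⟩))
    · exact Or.inr (Or.inr (Or.inl ⟨hl, Or.inr hm⟩))
    · refine Or.inr (Or.inr (Or.inr (Or.inr (Or.inr ⟨hl, hm, ?_⟩))))
      by_cases hlen : l.length = m.length
      · refine Or.inr fun j hj => ?_
        have hrot : m.drop j ++ m.take j = m.rotate j :=
          (List.rotate_eq_drop_append_take (by omega)).symm
        have hrot' : m.map (sval y) ~r (m.rotate j).map (sval y) := ⟨j, by rw [List.map_rotate]⟩
        rw [hrot]
        refine E.notTwisted_of_regular hφ hl hr (CycRed.isRotated hm hrot').red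
          (by simpa using hlen) fun hc => h ?_
        exact hc.trans (isConj_lprod_of_isRotated hrot').symm
      · exact Or.inl hlen

end Injective

end Effective

end Syllables

end AmalgCSP

/-! ## From the algorithms for the factors to syllables in a common alphabet -/

theorem Computable.of_bool_cases {β σ : Type*} [Primcodable β] [Primcodable σ]
    {f : Bool × β → σ} (h : ∀ i, Computable fun b => f (i, b)) : Computable f :=
  (Computable.cond Computable.fst ((h true).comp Computable.snd)
    ((h false).comp Computable.snd)).of_eq fun a => by
      obtain ⟨i, b⟩ := a
      cases i <;> rfl

theorem ComputablePred.of_bool_cases {β : Type*} [Primcodable β]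
    {p : Bool × β → Prop} (h : ∀ i, ComputablePred fun b => p (i, b)) : ComputablePred p := by
  classical
  exact ⟨inferInstance, Computable.of_bool_cases fun i =>
    computablePred_iff_computable_decide.1 (h i)⟩

namespace AmalgCSP

open Monoid

section Factor

variable {H : Type*} [Group H] {ι : Type} [Primcodable ι] {x : ι → H}

theorem ConjSearchDecidableOn.isConj_computable (h : ConjSearchDecidableOn x Set.univ) :
    ComputablePred fun t : Word ι × Word ι => IsConj (eval x t.1) (eval x t.2) := by
  obtain ⟨f, hf, hdom, hspec⟩ := h
  have htot : ∀ t, ∃ o, o ∈ f t := fun t => Part.dom_iff_mem.1 (hdom t.1 t.2 trivial)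
  choose g hg using htot
  have hgc : Computable g := hf.of_eq_tot hg
  refine (ComputablePred.of_bool (Primrec.option_isSome.to_comp.comp hgc)).of_eq fun t => ?_
  obtain ⟨u, v⟩ := t
  have hm := hg (u, v)
  rcases hgt : g (u, v) with _ | p <;> rw [hgt] at hm
  · simpa using (hspec u v).2 hm
  · simp only [Option.isSome_some, true_iff]
    exact isConj_iff.2 ⟨(eval x p)⁻¹, by simpa using (hspec u v).1 p hm⟩

theorem ConjMembershipSearchDecidable.computable {C : Type*} [Group C] {φ : C →* H}
    (h : ConjMembershipSearchDecidable x φ.range) :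
    ComputablePred fun w : Word ι => ∃ c, IsConj (eval x w) (φ c) := by
  obtain ⟨f, hf, hspec⟩ := h
  refine (ComputablePred.of_bool (Primrec.option_isSome.to_comp.comp hf)).of_eq fun w => ?_
  rcases hw : f w with _ | ⟨d, p⟩
  · simp only [Option.isSome_none, Bool.false_eq_true, false_iff]
    rintro ⟨c, hc⟩
    exact (hspec w).2 hw _ ⟨c, rfl⟩ hc
  · simp only [Option.isSome_some, true_iff]
    obtain ⟨⟨c, hc⟩, h2⟩ := (hspec w).1 d p hw
    exact ⟨c, isConj_iff.2 ⟨(eval x p)⁻¹, by simpa [hc] using h2⟩⟩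

end Factor

section Alphabet

variable {F : Bool → Type*} [∀ i, Group (F i)] {n : Bool → ℕ} (x : ∀ i, Fin (n i) → F i)

/-- The generators of a factor, extended trivially to the common alphabet. -/
def commonGen : ∀ i, Fin (n false) ⊕ Fin (n true) → F i
  | false => Sum.elim (x false) fun _ => 1
  | true => Sum.elim (fun _ => 1) (x true)

/-- The letters of a factor. -/
def restrictLetter : ∀ i : Bool, (Fin (n false) ⊕ Fin (n true)) × Bool → Word (Fin (n i))
  | false, a => a.1.elim (fun b => [(b, a.2)]) fun _ => []
  | true, a => a.1.elim (fun _ => []) fun b => [(b, a.2)]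

/-- Deletion of the letters that belong to the other factor. -/
def restrictWord (i : Bool) (w : Word (Fin (n false) ⊕ Fin (n true))) : Word (Fin (n i)) :=
  w.flatMap (restrictLetter i)

/-- The letter of the common alphabet. -/
def extendLetter : ∀ i : Bool, Fin (n i) → Fin (n false) ⊕ Fin (n true)
  | false, a => Sum.inl a
  | true, a => Sum.inr a

/-- A word in the generators of a factor as a word in the common alphabet. -/
def extendWord (i : Bool) (w : Word (Fin (n i))) : Word (Fin (n false) ⊕ Fin (n true)) :=
  w.map fun a => (extendLetter i a.1, a.2)

variable {x}

theorem eval_restrictWord (i : Bool) (w : Word (Fin (n false) ⊕ Fin (n true))) :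
    eval (x i) (restrictWord i w) = eval (commonGen x i) w := by
  induction w with
  | nil => simp [restrictWord]
  | cons a w ih =>
    rw [eval_cons, ← ih, restrictWord, List.flatMap_cons, eval_append]
    congr 1
    obtain ⟨a | a, b⟩ := a <;> cases i <;> cases b <;>
      simp [restrictLetter, commonGen, eval_singleton]

theorem eval_extendWord (i : Bool) (w : Word (Fin (n i))) :
    eval (commonGen x i) (extendWord i w) = eval (x i) w := by
  induction w with
  | nil => simp [extendWord]
  | cons a w ih =>
    rw [eval_cons, ← ih, extendWord, List.map_cons, eval_cons]
    congr 1
    obtain ⟨a, b⟩ := a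
    cases i <;> cases b <;> simp [extendLetter, commonGen, eval_singleton]

theorem eval_extendWord_of_ne {i j : Bool} (hij : i ≠ j) (w : Word (Fin (n i))) :
    eval (commonGen x j) (extendWord i w) = 1 := by
  induction w with
  | nil => simp [extendWord]
  | cons a w ih =>
    rw [extendWord, List.map_cons, eval_cons]
    refine (congrArg₂ _ ?_ ih).trans (mul_one 1)
    obtain ⟨a, b⟩ := a
    cases i <;> cases j <;> cases b <;> simp_all [extendLetter, commonGen, eval_singleton]

theorem restrictWord_computable (i : Bool) :
    Computable (restrictWord i : Word (Fin (n false) ⊕ Fin (n true)) → Word (Fin (n i))) :=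
  (Primrec.list_flatMap Primrec.id
    ((Primrec.dom_finite (restrictLetter (n := n) i)).comp Primrec.snd).to₂).to_comp

theorem extendWord_computable (i : Bool) :
    Computable (extendWord i : Word (Fin (n i)) → Word (Fin (n false) ⊕ Fin (n true))) :=
  (Primrec.list_map Primrec.id
    ((Primrec.dom_finite fun a : Fin (n i) × Bool => (extendLetter (n := n) i a.1, a.2)).comp
      Primrec.snd).to₂).to_comp

/-- Substitution of words for letters. -/
def substWord {κ ι : Type*} (s : κ → List (ι × Bool)) (w : List (κ × Bool)) : List (ι × Bool) :=
  w.flatMap fun a => bif a.2 then s a.1 else FreeGroup.invRev (s a.1)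

theorem eval_substWord {κ ι H K : Type*} [Group H] [Group K] {a : ι → H} {b : κ → K}
    {s : κ → List (ι × Bool)} {f : K →* H} (hs : ∀ j, eval a (s j) = f (b j))
    (w : List (κ × Bool)) : eval a (substWord s w) = f (eval b w) := by
  induction w with
  | nil => simp [substWord]
  | cons c w ih =>
    rw [eval_cons, map_mul, ← ih, substWord, List.flatMap_cons, eval_append]
    congr 1
    obtain ⟨c, d⟩ := c
    cases d <;> simp [eval_singleton, eval_invRev, hs]

theorem substWord_computable {k m : ℕ} (s : Fin k → Word (Fin m)) :
    Computable (substWord s) :=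
  (Primrec.list_flatMap Primrec.id ((Primrec.dom_finite fun a : Fin k × Bool =>
    bif a.2 then s a.1 else FreeGroup.invRev (s a.1)).comp Primrec.snd).to₂).to_comp

end Alphabet

/-! ### Coset computations from cardinality search -/

section Cardinality

variable {F : Bool → Type*} [∀ i, Group (F i)] {C : Type*} [Group C] {φ : ∀ i, C →* F i}
  {n : Bool → ℕ} {k : ℕ} {x : ∀ i, Fin (n i) → F i} {z : Fin k → C}

theorem CardinalitySearchDecidable.empty_computable {i : Bool}
    (h : CardinalitySearchDecidable φ x z i) :
    ComputablePred fun d : SetDesc n k i => SetDesc.den φ x z i d = ∅ := by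
  obtain ⟨f, hf, hspec⟩ := h
  refine (ComputablePred.eq hf (Computable.const (some []))).of_eq fun d => ?_
  rcases hd : f d with _ | l
  · simp only [reduceCtorEq, false_iff]
    exact ((hspec d).2 hd).nonempty.ne_empty
  · rw [(hspec d).1 l hd]
    match l with
    | [] => simp
    | w :: l =>
      refine iff_of_false (by simp) (Set.Nonempty.ne_empty ⟨eval (x i) w, w, by simp⟩)

/-- An infinite set is rejected; the elements of a finite one are listed and compared with `1` by
the conjugacy test. -/
theorem CardinalitySearchDecidable.subset_one_computable {i : Bool}
    (h : CardinalitySearchDecidable φ x z i) (hc : ConjSearchDecidableOn (x i) Set.univ) :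
    ComputablePred fun d : SetDesc n k i => SetDesc.den φ x z i d ⊆ {1} := by
  obtain ⟨f, hf, hspec⟩ := h
  have hall : ComputablePred fun d : SetDesc n k i =>
      ∀ w ∈ (f d).getD [], IsConj (eval (x i) w) (eval (x i) []) :=
    ComputablePred.forall_mem_list
      (p := fun t : SetDesc n k i × Word (Fin (n i)) => IsConj (eval (x i) t.2) (eval (x i) []))
      (hc.isConj_computable.comp (Computable.snd.pair (Computable.const [])))
      (Computable.option_getD hf (Computable.const _))
  refine ((ComputablePred.of_bool (Primrec.option_isSome.to_comp.comp hf)).and hall).of_eq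
    fun d => ?_
  rcases hd : f d with _ | l
  · simp only [Option.isSome_none, Bool.false_eq_true, false_and, false_iff]
    exact fun hsub => (hspec d).2 hd ((Set.finite_singleton 1).subset hsub)
  · rw [(hspec d).1 l hd]
    simp only [Option.isSome_some, Option.getD_some, eval_nil, isConj_one_left, true_and]
    constructor
    · rintro h _ ⟨w, hw, rfl⟩
      exact h w hw
    · exact fun h w hw => h ⟨w, hw, rfl⟩

variable (n) in
/-- The step of a description given by a syllable. -/
def descStep (s : Syl (Fin (n false) ⊕ Fin (n true))) :
    Word (Fin (n false)) ⊕ Word (Fin (n true)) :=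
  bif s.1 then Sum.inr (restrictWord true s.2) else Sum.inl (restrictWord false s.2)

variable (n k) in
/-- The description of `descSub`. -/
def sylDesc (P : List (Syl (Fin (n false) ⊕ Fin (n true)))) : SubDesc n k :=
  ((List.finRange k).map fun j => [(j, true)], P.map (descStep n))

theorem sylDesc_computable : Computable (sylDesc n k) := by
  have hstep : Primrec (descStep n) := by
    have hr (i : Bool) : Primrec (restrictWord (n := n) i) :=
      Primrec.list_flatMap Primrec.id
        ((Primrec.dom_finite (restrictLetter (n := n) i)).comp Primrec.snd).to₂
    exact Primrec.cond Primrec.fst (Primrec.sumInr.comp ((hr true).comp Primrec.snd))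
      (Primrec.sumInl.comp ((hr false).comp Primrec.snd))
  exact (Computable.const _).pair
    (Primrec.list_map Primrec.id (hstep.comp Primrec.snd).to₂).to_comp

theorem den_sylDesc (hz : Subgroup.closure (Set.range z) = ⊤)
    (P : List (Syl (Fin (n false) ⊕ Fin (n true)))) :
    SubDesc.den φ x z (sylDesc n k P) = descSub φ (P.map (sval (commonGen x))) := by
  induction P with
  | nil =>
    simp only [sylDesc, SubDesc.den, descSub, List.map_nil, List.foldr_nil]
    rw [eq_top_iff, ← hz, Subgroup.closure_le]
    rintro _ ⟨j, rfl⟩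
    exact Subgroup.subset_closure ⟨[(j, true)], by simp, by simp [eval_singleton]⟩
  | cons s P ih =>
    obtain ⟨i, w⟩ := s
    simp only [sylDesc, SubDesc.den, descSub, List.map_cons, List.foldr_cons] at ih ⊢
    rw [ih]
    cases i
    · simp [descStep, stepDesc, eval_restrictWord, sval]
    · simp [descStep, stepDesc, eval_restrictWord, sval]

theorem mem_shiftDen {i : Bool} {t : Word (Fin (n i)) × SubDesc n k × Word (Fin (n i))} {g : F i} :
    g ∈ shiftDen φ x z i t ↔ ∃ l ∈ SubDesc.den φ x z t.2.1,
      g = eval (x i) t.1 * φ i l * eval (x i) t.2.2 := by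
  simp only [shiftDen, Set.mem_image, SetLike.mem_coe, Subgroup.mem_map, exists_exists_and_eq_and]
  exact exists_congr fun l => and_congr_right fun _ => eq_comm

theorem den_trivial : SubDesc.den φ x z (([], []) : SubDesc n k) = ⊥ := by
  simp [SubDesc.den]

theorem mem_den_pair {i : Bool} {s t : Word (Fin (n i)) × SubDesc n k × Word (Fin (n i))}
    {g : F i} : g ∈ SetDesc.den φ x z i (s, [t]) ↔
      g ∈ shiftDen φ x z i s ∧ g ∈ shiftDen φ x z i t := by
  simp [SetDesc.den]

/-- The point is `pick`, which has to produce an element of `C ∩ u K v`. Emptiness of sets in the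
families decides both whether one exists and whether a given word is one; a search then finds it. -/
theorem nonempty_effective (hφ : ∀ i, Function.Injective (φ i))
    (hx : ∀ i, Subgroup.closure (Set.range (x i)) = ⊤)
    (hz : Subgroup.closure (Set.range z) = ⊤)
    (hMSP : ∀ i, MembershipSearchDecidable (x i) (φ i) z)
    (hCardSP : ∀ i, CardinalitySearchDecidable φ x z i)
    (hCSP : ∀ i, ConjSearchDecidableOn (x i) Set.univ)
    (hCMSP : ∀ i, ConjMembershipSearchDecidable (x i) (φ i).range)
    (hZ : ∀ i, MembershipDecidable (x i) (genCenter (φ i).range)) :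
    Nonempty (Effective φ (commonGen x)) := by
  let ι := Fin (n false) ⊕ Fin (n true)
  choose s hs using fun i j => eval_surjective (x i) (hx i) (φ i (z j))
  let tr : ∀ i, Word (Fin k) → Word (Fin (n i)) := fun i => substWord (s i)
  have htr : ∀ i w, eval (x i) (tr i w) = φ i (eval z w) := fun i w =>
    eval_substWord (hs i) w
  have htrc : ∀ i, Computable (tr i) := fun i => substWord_computable (s i)
  -- Each half is trivial in the other factor, so a single word represents the element of `C` in
  -- both factors.
  let rep : Word (Fin k) → Word ι := fun w =>
    extendWord false (tr false w) ++ extendWord true (tr true w)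
  have hrep : ∀ w, Represents φ (commonGen x) (rep w) (eval z w) := by
    intro w j
    cases j
    · simp [rep, eval_extendWord, eval_extendWord_of_ne, htr]
    · simp [rep, eval_extendWord, eval_extendWord_of_ne, htr]
  have hrepc : Computable rep := Computable.list_append.comp
    ((extendWord_computable false).comp (htrc false))
    ((extendWord_computable true).comp (htrc true))
  have hrc := fun i => restrictWord_computable (n := n) i
  choose fm hfmc hfm using hMSP
  let A := Word ι × List (Syl ι) × Word ι
  have hpick : ∀ i, ∃ f : A → Option (Word (Fin k)), Computable f ∧
      (∀ a w, f a = some w → ∃ l ∈ descSub φ (a.2.1.map (sval (commonGen x))),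
        φ i (eval z w) = eval (commonGen x i) a.1 * φ i l * eval (commonGen x i) a.2.2) ∧
      ∀ a, f a = none → ∀ w, ¬ ∃ l ∈ descSub φ (a.2.1.map (sval (commonGen x))),
        φ i (eval z w) = eval (commonGen x i) a.1 * φ i l * eval (commonGen x i) a.2.2 := by
    intro i
    have htc : Computable fun a : A =>
        (restrictWord i a.1, sylDesc n k a.2.1, restrictWord i a.2.2) :=
      ((hrc i).comp Computable.fst).pair
        ((sylDesc_computable.comp (Computable.fst.comp Computable.snd)).pair
          ((hrc i).comp (Computable.snd.comp Computable.snd)))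
    have hmem : ∀ (a : A) g, g ∈ shiftDen φ x z i
        (restrictWord i a.1, sylDesc n k a.2.1, restrictWord i a.2.2) ↔
        ∃ l ∈ descSub φ (a.2.1.map (sval (commonGen x))),
          g = eval (commonGen x i) a.1 * φ i l * eval (commonGen x i) a.2.2 := by
      intro a g
      rw [mem_shiftDen, den_sylDesc hz, eval_restrictWord, eval_restrictWord]
    refine ComputablePred.exists_choice (p := fun t : A × Word (Fin k) =>
      ∃ l ∈ descSub φ (t.1.2.1.map (sval (commonGen x))),
        φ i (eval z t.2) = eval (commonGen x i) t.1.1 * φ i l * eval (commonGen x i) t.1.2.2) ?_ ?_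
    -- Membership of one element in `u K v`: the element is the shift of the trivial subgroup, and
    -- it is intersected with `u K v`.
    · refine ((hCardSP i).empty_computable.not.comp (f := fun t : A × Word (Fin k) =>
        ((tr i t.2, ([], []), []),
          [(restrictWord i t.1.1, sylDesc n k t.1.2.1, restrictWord i t.1.2.2)])) ?_).of_eq ?_
      · exact Computable.pair (((htrc i).comp Computable.snd).pair (Computable.const _))
          (Computable.list_cons.comp (htc.comp Computable.fst) (Computable.const []))
      · intro t
        rw [← hmem, ← ne_eq, ← Set.nonempty_iff_ne_empty]
        constructor
        · rintro ⟨g, hg⟩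
          obtain ⟨h1, h2⟩ := mem_den_pair.1 hg
          obtain ⟨l, hl, rfl⟩ := mem_shiftDen.1 h1
          rw [den_trivial, Subgroup.mem_bot] at hl
          rw [← htr]
          simpa [hl] using h2
        · exact fun h => ⟨_, mem_den_pair.2 ⟨mem_shiftDen.2 ⟨1, one_mem _, by simp [htr]⟩, h⟩⟩
    -- Existence of an element: the empty list of steps describes the whole of `C`, which is
    -- intersected with `u K v`.
    · refine ((hCardSP i).empty_computable.not.comp (f := fun a : A =>
        (([], sylDesc n k [], []),
          [(restrictWord i a.1, sylDesc n k a.2.1, restrictWord i a.2.2)])) ?_).of_eq ?_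
      · exact Computable.pair (Computable.const _)
          (Computable.list_cons.comp htc (Computable.const []))
      · intro a
        rw [← ne_eq, ← Set.nonempty_iff_ne_empty]
        constructor
        · rintro ⟨g, hg⟩
          obtain ⟨h1, h2⟩ := mem_den_pair.1 hg
          obtain ⟨c, -, hc⟩ := mem_shiftDen.1 h1
          obtain ⟨w, rfl⟩ := eval_surjective z hz c
          have hc' : g = φ i (eval z w) := by simpa using hc
          exact ⟨w, (hmem a _).1 (hc' ▸ h2)⟩
        · rintro ⟨w, hw⟩
          refine ⟨φ i (eval z w), mem_den_pair.2 ⟨mem_shiftDen.2 ⟨eval z w, ?_, by simp⟩,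
            (hmem a _).2 hw⟩⟩
          rw [den_sylDesc hz]
          trivial
  choose fp hfpc hfps hfpn using hpick
  exact ⟨{
    mem := fun s => (fm s.1 (restrictWord s.1 s.2)).map rep
    mem_computable := Computable.of_bool_cases fun i =>
      Computable.option_map ((hfmc i).comp (hrc i)) (hrepc.comp Computable.snd)
    mem_some := by
      rintro ⟨i, w⟩ v hv
      obtain ⟨c, hc, rfl⟩ := Option.map_eq_some_iff.1 hv
      exact ⟨eval z c, hrep c, by rw [(hfm i _).1 c hc, eval_restrictWord]⟩
    mem_none := by
      rintro ⟨i, w⟩ hw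
      have := (hfm i _).2 (Option.map_eq_none_iff.1 hw)
      rwa [eval_restrictWord] at this
    isConj := ComputablePred.of_bool_cases fun i =>
      ((hCSP i).isConj_computable.comp (((hrc i).comp Computable.fst).pair
        ((hrc i).comp Computable.snd))).of_eq fun t => by
          rw [eval_restrictWord, eval_restrictWord]
    conjBase := ComputablePred.of_bool_cases fun i =>
      ((hCMSP i).computable.comp (hrc i)).of_eq fun t => by rw [eval_restrictWord]
    center := ComputablePred.of_bool_cases fun i =>
      (ComputablePred.comp (hZ i) (hrc i)).of_eq fun t => by rw [eval_restrictWord]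
    pick := fun t => (fp t.1 t.2).map rep
    pick_computable := Computable.of_bool_cases fun i =>
      Computable.option_map (hfpc i) (hrepc.comp Computable.snd)
    pick_some := by
      intro i u P v e he
      obtain ⟨c, hc, rfl⟩ := Option.map_eq_some_iff.1 he
      exact ⟨eval z c, hrep c, hfps i _ c hc⟩
    pick_none := by
      intro i u P v he c l hl h
      obtain ⟨w, rfl⟩ := eval_surjective z hz c
      exact hfpn i _ (Option.map_eq_none_iff.1 he) w ⟨l, hl, h⟩
    triv := by
      refine (((hCardSP false).subset_one_computable (hCSP false)).comp
        (f := fun P => (([], sylDesc n k P, []), [])) ?_).of_eq fun P => ?_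
      · exact Computable.pair ((Computable.const _).pair
          (sylDesc_computable.pair (Computable.const _))) (Computable.const _)
      · rw [← den_sylDesc hz, Subgroup.eq_bot_iff_forall]
        constructor
        · intro h c hc
          have : φ false c ∈ ({1} : Set (F false)) := h (by
            simp only [SetDesc.den, List.mem_singleton, forall_eq]
            exact mem_shiftDen.2 ⟨c, hc, by simp⟩)
          exact hφ false (this.trans (map_one _).symm)
        · rintro h g hg
          simp only [SetDesc.den, List.mem_singleton, forall_eq] at hg
          obtain ⟨c, hc, hg'⟩ := mem_shiftDen.1 hg
          rw [h c hc] at hg'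
          simpa using hg' }⟩

end Cardinality

end AmalgCSP

/-! ## The conjugacy search problem in the amalgamated product -/

namespace AmalgCSP

open Monoid

section Representatives

variable {F : Bool → Type*} [∀ i, Group (F i)] {C : Type*} [Group C] {φ : ∀ i, C →* F i}

variable (φ) in
/-- The list is an element of `C`, or an element of a factor that is not conjugate there to an
element of `C`, or cyclically reduced. -/
def IsConjRep (l : List (Σ i, F i)) : Prop :=
  (∃ s, l = [s] ∧ (s.2 ∈ (φ s.1).range ∨ ¬ ∃ c, IsConj s.2 (φ s.1 c))) ∨ CycRed φ l

theorem exists_isConjRep (g : PushoutI φ) : ∃ l, IsConjRep φ l ∧ IsConj g (lprod φ l) := by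
  obtain ⟨l, hl, ⟨⟨i, a⟩, rfl⟩ | hc⟩ := exists_conj_syllable_or_cycRed g
  · by_cases h : ∃ c, IsConj a (φ i c)
    · obtain ⟨c, hc⟩ := h
      refine ⟨[⟨i, φ i c⟩], Or.inl ⟨_, rfl, Or.inl ⟨c, rfl⟩⟩, hl.trans ?_⟩
      simpa using MonoidHom.map_isConj (PushoutI.of (φ := φ) i) hc
    · exact ⟨_, Or.inl ⟨_, rfl, Or.inr h⟩, hl⟩
  · exact ⟨l, Or.inr hc, hl⟩

/-- The prefix from `C` is absorbed into the first syllable. The representative has value exactly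
`g`, so that the regularity of `g` passes to it without any invariance under conjugation. -/
theorem IsCyclicallyReduced.exists_isConjRep {g : PushoutI φ} (h : IsCyclicallyReduced φ g) :
    ∃ l, IsConjRep φ l ∧ lprod φ l = g := by
  obtain ⟨c, ⟨L, hne, hchain⟩, hred, rfl, hcase⟩ := h
  have hprod : (PushoutI.ofCoprodI (CoprodI.Word.prod ⟨L, hne, hchain⟩) : PushoutI φ) =
      lprod φ L := by
    simp [CoprodI.Word.prod, lprod, map_list_prod, Function.comp_def]
  rw [hprod] at hcase ⊢
  have hbase : NoBase φ L := hred
  match L with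
  | [] =>
    exact ⟨[⟨false, φ false c⟩], Or.inl ⟨_, rfl, Or.inl ⟨c, rfl⟩⟩, by simp [← base_eq]⟩
  | [s] =>
    refine ⟨[⟨s.1, φ s.1 c * s.2⟩], Or.inl ⟨_, rfl, Or.inr ?_⟩, lprod_absorb s [] c⟩
    rintro ⟨d, hd⟩
    obtain h | ⟨-, hn⟩ | ⟨h, -⟩ := hcase
    · simp at h
    · refine hn d ?_
      simpa [base_eq s.1] using MonoidHom.map_isConj (PushoutI.of (φ := φ) s.1) hd
    · simp at h
  | s :: t :: L =>
    refine ⟨⟨s.1, φ s.1 c * s.2⟩ :: t :: L, Or.inr ⟨by simp, ?_⟩, lprod_absorb s _ c⟩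
    have hr : Red φ (⟨s.1, φ s.1 c * s.2⟩ :: t :: L) :=
      Red.absorb ⟨by rw [List.isChain_map]; exact hchain, hbase⟩ c
    refine ⟨?_, noBase_append.2 ⟨hr.2, hr.2⟩⟩
    rw [List.map_append, List.isChain_append]
    refine ⟨hr.1, hr.1, ?_⟩
    have hends : s.1 ≠ ((t :: L).getLast (by simp)).1 := by
      simpa [List.getLast?_eq_getLast_of_ne_nil] using hcase
    intro i hi j hj
    have hi' : ((t :: L).getLast (by simp)).1 = i := by
      rw [List.getLast?_map, List.getLast?_eq_getLast_of_ne_nil (by simp),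
        List.getLast_cons (by simp)] at hi
      simpa using hi
    have hj' : s.1 = j := by simpa using hj
    rw [← hi', ← hj']
    exact hends.symm

theorem IsConjRep.exists_syl {ι : Type} [Primcodable ι] {y : ∀ i, ι → F i} (E : Effective φ y)
    (hy : ∀ i g, ∃ w, eval (y i) w = g) {L : List (Σ i, F i)} (h : IsConjRep φ L) :
    ∃ l : List (Syl ι), lval φ y l = lprod φ L ∧
      (E.IsBaseSyl l ∨ Effective.IsHyperSyl φ y l ∨ Effective.IsCyc φ y l) := by
  have hsurj : Function.Surjective (sval y) := by
    rintro ⟨i, g⟩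
    obtain ⟨w, rfl⟩ := hy i g
    exact ⟨(i, w), rfl⟩
  obtain ⟨l, rfl⟩ := List.map_surjective_iff.2 hsurj L
  refine ⟨l, rfl, ?_⟩
  rcases h with ⟨s, hs, h⟩ | h
  · have hlen := congrArg List.length hs
    rw [List.length_map, List.length_singleton] at hlen
    obtain ⟨t, rfl⟩ := List.length_eq_one_iff.1 hlen
    obtain rfl : sval y t = s := by simpa using hs
    rcases h with h | h
    · refine Or.inl ⟨rfl, ?_⟩
      rw [Option.isSome_iff_ne_none]
      exact fun hn => E.mem_none _ hn h
    · exact Or.inr (Or.inl ⟨rfl, h⟩)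
  · exact Or.inr (Or.inr h)

end Representatives

/-! ### The search for a conjugator or a certificate -/

section Main

variable {F : Bool → Type*} [∀ i, Group (F i)] {C : Type*} [Group C] (φ : ∀ i, C →* F i)
  {n : Bool → ℕ} (x : ∀ i, Fin (n i) → F i)

/-- The syllables of a word in the generators of the amalgamated product. -/
def syllables (w : Word (Fin (n false) ⊕ Fin (n true))) :
    List (Syl (Fin (n false) ⊕ Fin (n true))) :=
  w.map fun a => (a.1.isRight, [a])

theorem lval_syllables (w : Word (Fin (n false) ⊕ Fin (n true))) :
    lval φ (commonGen x) (syllables w) = eval (amalgGen φ x) w := by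
  induction w with
  | nil => simp [syllables, lval]
  | cons a w ih =>
    rw [eval_cons, ← ih, syllables, List.map_cons, lval_cons]
    congr 1
    rw [eval_singleton, eval_singleton]
    obtain ⟨a | a, b⟩ := a <;> cases b <;> rfl

theorem syllables_computable : Computable (syllables (n := n)) :=
  (Primrec.list_map Primrec.id
    ((Primrec.dom_finite fun a : (Fin (n false) ⊕ Fin (n true)) × Bool => a.1.isRight).comp
      Primrec.snd |>.pair (Primrec.list_cons.comp Primrec.snd (Primrec.const []))).to₂).to_comp

theorem eval_amalgGen_surjective (hx : ∀ i, Subgroup.closure (Set.range (x i)) = ⊤)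
    (g : PushoutI φ) : ∃ w, eval (amalgGen φ x) w = g := by
  have hof : ∀ i h, ∃ w, eval (amalgGen φ x) w = PushoutI.of i h := by
    intro i h
    obtain ⟨w, rfl⟩ := eval_surjective (x i) (hx i) h
    refine ⟨extendWord i w, ?_⟩
    induction w with
    | nil => simp [extendWord]
    | cons a w ih =>
      rw [eval_cons, map_mul, ← ih, extendWord, List.map_cons, eval_cons]
      congr 1
      obtain ⟨a, b⟩ := a
      cases i <;> cases b <;> simp [eval_singleton, extendLetter, amalgGen]
  induction g using PushoutI.induction_on with
  | of i h => exact hof i h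
  | base c => exact base_eq (φ := φ) false c ▸ hof false _
  | mul a b ha hb =>
    obtain ⟨v, rfl⟩ := ha
    obtain ⟨w, rfl⟩ := hb
    exact ⟨v ++ w, eval_append _ _ _⟩

theorem Effective.conjSearchDecidableOn (E : Effective φ (commonGen x))
    (hφ : ∀ i, Function.Injective (φ i))
    (hx : ∀ i, Subgroup.closure (Set.range (x i)) = ⊤) :
    ConjSearchDecidableOn (amalgGen φ x) (CR φ ×ˢ Set.univ) := by
  let W := Word (Fin (n false) ⊕ Fin (n true))
  let S := List (Syl (Fin (n false) ⊕ Fin (n true)))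
  let val : S → PushoutI φ := lval φ (commonGen x)
  let ev : W → PushoutI φ := eval (amalgGen φ x)
  -- The Boolean tells which kind of witness is offered. In the conjugator case only the first word
  -- is used and the other entries are padding.
  let Q : (W × W) × Bool × (W × S) × (W × S) → Prop := fun t =>
    (t.2.1 = true ∧ (ev t.2.2.1.1)⁻¹ * ev t.1.1 * ev t.2.2.1.1 = ev t.1.2) ∨
    (t.2.1 = false ∧ (ev t.2.2.1.1)⁻¹ * ev t.1.1 * ev t.2.2.1.1 = val t.2.2.1.2 ∧
      (ev t.2.2.2.1)⁻¹ * ev t.1.2 * ev t.2.2.2.1 = val t.2.2.2.2 ∧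
      E.NotConj t.2.2.1.2 t.2.2.2.2)
  have hQ : ComputablePred Q := by
    let A := (W × W) × Bool × (W × S) × (W × S)
    have hu : Computable fun t : A => syllables t.1.1 :=
      syllables_computable.comp (Computable.fst.comp Computable.fst)
    have hv : Computable fun t : A => syllables t.1.2 :=
      syllables_computable.comp (Computable.snd.comp Computable.fst)
    have hb : Computable fun t : A => t.2.1 := Computable.fst.comp Computable.snd
    have hc : Computable fun t : A => t.2.2.1 :=
      Computable.fst.comp (Computable.snd.comp Computable.snd)
    have hd : Computable fun t : A => t.2.2.2 :=
      Computable.snd.comp (Computable.snd.comp Computable.snd)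
    have hp : Computable fun t : A => syllables t.2.2.1.1 :=
      syllables_computable.comp (Computable.fst.comp hc)
    have hq : Computable fun t : A => syllables t.2.2.2.1 :=
      syllables_computable.comp (Computable.fst.comp hd)
    have hl : Computable fun t : A => t.2.2.1.2 := Computable.snd.comp hc
    have hm : Computable fun t : A => t.2.2.2.2 := Computable.snd.comp hd
    have hconj := E.conj_eq hφ
    refine (((ComputablePred.eq hb (Computable.const true)).and
      (hconj.comp (hp.pair (hu.pair hv)))).or
      ((ComputablePred.eq hb (Computable.const false)).and
      ((hconj.comp (hp.pair (hu.pair hl))).and ((hconj.comp (hq.pair (hv.pair hm))).and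
      ((E.notConj_computable hφ).comp (hl.pair hm)))))).of_eq fun t => ?_
    simp only [Q, lval_syllables]
    rfl
  obtain ⟨f, hf, hdom, hspec⟩ := hQ.exists_search
  have hsound : ∀ u v p l q m, (ev p)⁻¹ * ev u * ev p = val l → (ev q)⁻¹ * ev v * ev q = val m →
      (IsConj (ev u) (ev v) ↔ IsConj (val l) (val m)) := by
    intro u v p l q m h1 h2
    have hu : IsConj (ev u) (val l) := isConj_iff.2 ⟨(ev p)⁻¹, by simpa using h1⟩
    have hv : IsConj (ev v) (val m) := isConj_iff.2 ⟨(ev q)⁻¹, by simpa using h2⟩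
    exact ⟨fun h => (hu.symm.trans h).trans hv, fun h => (hu.trans h).trans hv.symm⟩
  refine ⟨fun t => (f t).map fun r => bif r.1 then some r.2.1.1 else none, ?_, ?_, ?_⟩
  · have hg : Computable₂ fun (_ : W × W) (r : Bool × (W × S) × (W × S)) =>
        bif r.1 then some r.2.1.1 else none :=
      Computable.cond (Computable.fst.comp Computable.snd)
        (Computable.option_some.comp (Computable.fst.comp (Computable.fst.comp
          (Computable.snd.comp Computable.snd)))) (Computable.const none)
    exact hf.map hg
  · rintro u v ⟨⟨r, hcyc, hreg, hur⟩, -⟩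
    change (f (u, v)).Dom
    rw [hdom]
    have hw : ∀ {g h : PushoutI φ}, IsConj g h → ∃ p, (ev p)⁻¹ * g * ev p = h := by
      intro g h hgh
      obtain ⟨a, ha⟩ := isConj_iff.1 hgh
      obtain ⟨p, hp⟩ := eval_amalgGen_surjective φ x hx a⁻¹
      exact ⟨p, by rw [← ha, show ev p = a⁻¹ from hp, inv_inv]⟩
    by_cases huv : IsConj (ev u) (ev v)
    · obtain ⟨p, hp⟩ := hw huv
      exact ⟨(true, (p, []), ([], [])), Or.inl ⟨rfl, hp⟩⟩
    · have hy : ∀ i g, ∃ w, eval (commonGen x i) w = g := by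
        intro i g
        obtain ⟨w, rfl⟩ := eval_surjective (x i) (hx i) g
        exact ⟨extendWord i w, eval_extendWord i w⟩
      -- On the side of `u` the representative has the regular element itself as value; on the side
      -- of `v` any conjugate representative will do.
      obtain ⟨L, hL, rfl⟩ := hcyc.exists_isConjRep
      obtain ⟨M, hM, hvM⟩ := exists_isConjRep (ev v)
      obtain ⟨l, hl, hlt⟩ := hL.exists_syl E hy
      obtain ⟨m, hm, hmt⟩ := hM.exists_syl E hy
      obtain ⟨p, hp⟩ := hw hur
      obtain ⟨q, hq⟩ := hw hvM
      have hp' : (ev p)⁻¹ * ev u * ev p = val l := hp.trans hl.symm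
      have hq' : (ev q)⁻¹ * ev v * ev q = val m := hq.trans hm.symm
      refine ⟨(false, (p, l), (q, m)), Or.inr ⟨rfl, hp', hq', ?_⟩⟩
      refine E.notConj_of_regular hφ hlt hmt (hl.symm ▸ hreg) ?_
      exact fun h => huv ((hsound u v p l q m hp' hq').2 h)
  · intro u v
    constructor
    · intro p hp
      obtain ⟨⟨b, ⟨p', l⟩, q, m⟩, hr, hrp⟩ := (Part.mem_map_iff _).1 hp
      cases b
      · simp at hrp
      · obtain rfl : p' = p := by simpa using hrp
        rcases hspec _ _ hr with ⟨-, h⟩ | ⟨h, -⟩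
        · exact h
        · simp at h
    · intro hn
      obtain ⟨⟨b, ⟨p', l⟩, q, m⟩, hr, hrp⟩ := (Part.mem_map_iff _).1 hn
      cases b
      · rcases hspec _ _ hr with ⟨h, -⟩ | ⟨-, h1, h2, h3⟩
        · simp at h
        · exact fun h => h3.sound E hφ ((hsound u v p' l q m h1 h2).1 h)
      · simp at hrp

end Main

end AmalgCSP

theorem theorem4p18
    {F : Bool → Type*} [∀ i, Group (F i)] {C : Type*} [Group C]
    (φ : ∀ i, C →* F i) (hφ : ∀ i, Function.Injective (φ i))
    (hfp : ∀ i, Group.IsFinitelyPresented (F i))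
    {n : Bool → ℕ} (x : ∀ i, Fin (n i) → F i)
    (hx : ∀ i, Subgroup.closure (Set.range (x i)) = ⊤)
    {k : ℕ} (z : Fin k → C) (hz : Subgroup.closure (Set.range z) = ⊤)
    (hMSP : ∀ i, MembershipSearchDecidable (x i) (φ i) z)
    (hCRSP : ∀ i, CosetRepSearchDecidable (x i) (φ i).range)
    (hCardSP : ∀ i, CardinalitySearchDecidable φ x z i)
    (hCSP : ∀ i, ConjSearchDecidableOn (x i) Set.univ)
    (hCMSP : ∀ i, ConjMembershipSearchDecidable (x i) (φ i).range)
    (hN : ∀ i, MembershipDecidable (x i) (genNormalizer (φ i).range))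
    (hZ : ∀ i, MembershipDecidable (x i) (genCenter (φ i).range)) :
    ConjSearchDecidableOn (amalgGen φ x) (CR φ ×ˢ Set.univ) := by
  obtain ⟨E⟩ := nonempty_effective hφ hx hz hMSP hCardSP hCSP hCMSP hZ
  exact E.conjSearchDecidableOn φ x hφ hx
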